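/- Let $G$ be a labeled graph on $n\ge 2$ vertices, that is, a complete graph on the vertex set $\{0,\dots,n-1\}$ each of whose edges is labeled $(+)$ or $(-)$, and let $G^-$ be the subgraph of its $(-)$-edges. The cost of a clustering (a partition of the vertices) is the number of $(+)$-edges between different clusters plus the number of $(-)$-edges inside clusters; an $\alpha$-approximation is a clustering whose cost is at most $\alpha$ times the cost of every clustering. There are absolute constants $\alpha$ and $k$ such that for every $c\in\mathbb N$ there is a randomized single-pass streaming algorithm (one word-RAM program, the same for all $n$) with the following property. For every $n \ge 2$ and every labeled graph $G$ on $n$ vertices, if the algorithm is given $n$ and a stream that contains exactly the edges of $G^-$, each one once, in an arbitrary order, then it always halts, it uses $O(n\log^k n)=\tilde O(n)$ words of memory of $O(\log n)$ bits each, and with probability at least $1-n^{-c}$ it outputs an $\alpha$-approximation to the correlation clustering problem on $G$. The implied constants depend only on $c$. -/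

import Mathlib

open MeasureTheory

/-! ### Correlation clustering -/

/-- A labeled graph on `V`: the complete graph on `V` whose edges carry labels `+1` or `-1`.
The values of `label` on loops are never used. -/
structure LabeledGraph (V : Type*) where
  label : Sym2 V → ℤˣ

namespace LabeledGraph

variable {V : Type*}

/-- The subgraph `G⁻` of the edges labeled `-1` (`fromEdgeSet` discards loops). -/
def neg (G : LabeledGraph V) : SimpleGraph V :=
  SimpleGraph.fromEdgeSet {e | G.label e = -1}

/-- The endpoints of `e` lie in the same cluster of the clustering `C`; a clustering is a
partition of the vertices, given by its equivalence relation. -/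
def Together (C : Setoid V) (e : Sym2 V) : Prop :=
  e ∈ Sym2.fromRel (r := C) ⟨fun _ _ h => C.symm h⟩

open Classical in
/-- The cost of an edge: `1` for a `(+)`-edge between clusters and for a `(-)`-edge inside
a cluster, `0` otherwise. -/
noncomputable def edgeCost (G : LabeledGraph V) (C : Setoid V) (e : Sym2 V) : ℕ :=
  if G.label e = 1 ∧ ¬ Together C e then 1
  else if G.label e = -1 ∧ Together C e then 1
  else 0

/-- The total cost of a clustering, over all edges of the complete graph. -/
noncomputable def cost [Fintype V] [DecidableEq V] (G : LabeledGraph V) (C : Setoid V) : ℕ :=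
  ∑ e ∈ (⊤ : SimpleGraph V).edgeFinset, G.edgeCost C e

/-- `C` is an `α`-approximation to the correlation clustering problem on `G`. -/
def IsApprox [Fintype V] [DecidableEq V] (α : ℝ) (G : LabeledGraph V) (C : Setoid V) : Prop :=
  ∀ C' : Setoid V, (G.cost C : ℝ) ≤ α * (G.cost C' : ℝ)

end LabeledGraph

/-- `L` is a stream of the edges of `H`: every edge of `H` occurs exactly once, in an arbitrary
order and with its endpoints in an arbitrary order, and nothing else occurs. -/
def IsEdgeStream {V : Type*} (H : SimpleGraph V) (L : List (V × V)) : Prop :=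
  (L.map fun p => s(p.1, p.2)).Nodup ∧ ∀ e, e ∈ L.map (fun p => s(p.1, p.2)) ↔ e ∈ H.edgeSet

/-! ### Randomized single-pass streaming algorithms

A word RAM with finitely many registers per program, a memory of `S` words, words holding the
numbers below `W`, a one-way coin tape and a one-way input stream. A computed value that does not
fit into a word, or an access outside the memory, is a fault: such a computation has no result. -/

namespace StreamRAM

/-- Binary word operations; comparisons yield `1` or `0`. -/
inductive BinOp
  | add | sub | mul | div | mod | lt | eq

/-- Subtraction is truncated at `0`; division and remainder are those of the natural numbers
(`x / 0 = 0`, `x % 0 = x`). -/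
def BinOp.apply : BinOp → ℕ → ℕ → ℕ
  | .add, x, y => x + y
  | .sub, x, y => x - y
  | .mul, x, y => x * y
  | .div, x, y => x / y
  | .mod, x, y => x % y
  | .lt, x, y => if x < y then 1 else 0
  | .eq, x, y => if x = y then 1 else 0

/-- Expressions: constants, registers, memory cells and operations. -/
inductive Expr
  | lit (k : ℕ)
  | reg (r : ℕ)
  | load (a : Expr)
  | bin (o : BinOp) (e f : Expr)

/-- Programs. -/
inductive Cmd
  | skip
  /-- register `r` := `e` -/
  | assign (r : ℕ) (e : Expr)
  /-- memory cell `a` := `e` -/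
  | store (a e : Expr)
  /-- consume the next element `(x, y)` of the stream: registers `r`, `u`, `v` := `1`, `x`, `y`;
  at the end of the stream register `r` := `0` -/
  | next (r u v : ℕ)
  /-- register `r` := a fresh fair coin flip -/
  | coin (r : ℕ)
  | seq (c d : Cmd)
  /-- run `c` if `e ≠ 0`, else `d` -/
  | ite (e : Expr) (c d : Cmd)
  /-- run `c` as long as `e ≠ 0` -/
  | loop (e : Expr) (c : Cmd)

/-- A configuration: registers, memory, the unread part of the stream, and the number of coins
used so far. -/
structure State where
  reg : ℕ → ℕ
  mem : ℕ → ℕ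
  input : List (ℕ × ℕ)
  used : ℕ

def State.setReg (s : State) (r x : ℕ) : State := { s with reg := Function.update s.reg r x }

def State.setMem (s : State) (a x : ℕ) : State := { s with mem := Function.update s.mem a x }

/-- The value of an expression; `none` is a fault. -/
def Expr.eval (S W : ℕ) (s : State) : Expr → Option ℕ
  | .lit k => if k < W then some k else none
  | .reg r => some (s.reg r)
  | .load a => (a.eval S W s).bind fun i => if i < S then some (s.mem i) else none
  | .bin o e f => (e.eval S W s).bind fun x => (f.eval S W s).bind fun y =>
      if o.apply x y < W then some (o.apply x y) else none

/-- `Exec S W ω c s t`: on the coin tape `ω`, the program `c` started in `s` halts in `t`, without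
ever using a memory cell outside the first `S` ones or computing a value that is not below `W`. -/
inductive Exec (S W : ℕ) (ω : ℕ → Bool) : Cmd → State → State → Prop
  | skip {s} : Exec S W ω .skip s s
  | assign {s r e x} : e.eval S W s = some x → Exec S W ω (.assign r e) s (s.setReg r x)
  | store {s a e i x} : a.eval S W s = some i → i < S → e.eval S W s = some x →
      Exec S W ω (.store a e) s (s.setMem i x)
  | next_cons {s r u v x y l} : s.input = (x, y) :: l →
      Exec S W ω (.next r u v) s
        ((({ s with input := l } : State).setReg r 1).setReg u x |>.setReg v y)
  | next_nil {s r u v} : s.input = [] → Exec S W ω (.next r u v) s (s.setReg r 0)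
  | coin {s r} : Exec S W ω (.coin r) s
      (({ s with used := s.used + 1 } : State).setReg r (ω s.used).toNat)
  | seq {c d s t w} : Exec S W ω c s t → Exec S W ω d t w → Exec S W ω (.seq c d) s w
  | ite_true {e c d s t x} : e.eval S W s = some x → x ≠ 0 → Exec S W ω c s t →
      Exec S W ω (.ite e c d) s t
  | ite_false {e c d s t} : e.eval S W s = some 0 → Exec S W ω d s t →
      Exec S W ω (.ite e c d) s t
  | loop_true {e c s t w x} : e.eval S W s = some x → x ≠ 0 → Exec S W ω c s t →
      Exec S W ω (.loop e c) t w → Exec S W ω (.loop e c) s w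
  | loop_false {e c s} : e.eval S W s = some 0 → Exec S W ω (.loop e c) s s

/-- A computation has at most one result. -/
theorem Exec.unique {S W : ℕ} {ω : ℕ → Bool} {c : Cmd} {s t t' : State}
    (h : Exec S W ω c s t) (h' : Exec S W ω c s t') : t = t' := by
  induction h generalizing t' with
  | seq _ _ ih₁ ih₂ => cases h' with | seq a b => cases ih₁ a; exact ih₂ b
  | loop_true _ _ _ _ ih₁ ih₂ => cases h' <;> grind
  | _ => cases h' <;> grind

/-- The initial configuration for the vertex set `Fin n` and the stream `L`: register `0` holds
`n`, all other registers and all memory cells are `0`. -/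
def State.init (n : ℕ) (L : List (Fin n × Fin n)) : State where
  reg := Function.update (fun _ => 0) 0 n
  mem := fun _ => 0
  input := L.map fun p => (p.1.val, p.2.val)
  used := 0

/-- The clustering that a final configuration represents: memory cell `v` holds the name of the
cluster of the vertex `v`. -/
def State.output (n : ℕ) (s : State) : Setoid (Fin n) := Setoid.ker fun v : Fin n => s.mem v.val

/-- The distribution of a tape of independent fair coin flips. -/
noncomputable def coinTape : Measure (ℕ → Bool) :=
  Measure.infinitePi fun _ => (PMF.uniformOfFintype Bool).toMeasure

end StreamRAM

/-! Write `N v` for the closed neighborhood of `v` in the graph of (+)-edges. Twice the cost of a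
clustering is the sum over `v` of the size of the symmetric difference of `N v` and the cluster of
`v` (`LabeledGraph.two_mul_cost`). Distances between sets can be estimated from a small linear
sketch: with random signs, the square of a signed sum of the difference of two indicator vectors has
the size of the symmetric difference as its mean, and summing `m = O(log n)` independent squares
gives `m` times that size up to a factor `4`, outside an event of probability `exp(-Ω(m))`
(`card_bad_sketch_le`). The sketch is updated edge by edge, in any order.

Clusters themselves cannot all be sketched accurately this way: there are exponentially many
candidates, and the union bound would fail. They are therefore compared with polynomially many sets,
the balls `nearBall`: for a center `u` and a scale `s ≤ n`, the vertices whose estimated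
neighborhood distance from `u` is below a fixed multiple of `s`. A cluster is named by a center and
a scale, and its cost is replaced by `surrogate`: the estimated distance from `N v` to `N u`, the
estimated distance from `N u` to the ball, and the exact mismatch between ball and cluster. By the
triangle inequality the surrogate dominates the cost (`IsAccurate.cost_le_surrogate`). Conversely
every clustering can be changed into a named one of comparable surrogate
(`IsAccurate.exists_surrogate_le`): a cluster close to the neighborhoods of its members is almost a
ball around its best member, and a cluster that is not already costs so much that it can be split
into singletons.

The balls depend on the signs that estimate distances between neighborhoods. A second, independent
block of `m` sign rows estimates the distances to the balls, so that each ball is fixed before the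
signs that measure it are drawn.

The program stores `2 * m` rows of signs and of sketches and then minimizes the surrogate by
exhaustive search; only memory and termination matter, not time. The search is a counter that runs
through all namings again and again, with the number of completed rounds as threshold: it stops at
the first naming whose objective is at most the threshold, which is a minimizer, and no second
clustering has to be stored (`run_searchCmd`). Halting and the absence of faults hold on every coin
tape; only accuracy is random. -/

open scoped symmDiff

/-! ### Exponential moments of random signed sums -/

/-- The value `±1` of a bit. -/
def bitSign (b : Bool) : ℝ := if b then 1 else -1

/-- The average of `f` over all bit vectors. -/
noncomputable def bitAvg {n : ℕ} (f : (Fin n → Bool) → ℝ) : ℝ := (∑ y, f y) / 2 ^ n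

theorem bitAvg_succ {n : ℕ} (f : (Fin (n + 1) → Bool) → ℝ) :
    bitAvg f = bitAvg fun y => (f (Fin.cons true y) + f (Fin.cons false y)) / 2 := by
  unfold bitAvg
  rw [← (Fin.consEquiv fun _ => Bool).sum_comp, Fintype.sum_prod_type]
  simp only [Fin.consEquiv, Equiv.coe_fn_mk, Fintype.sum_bool]
  rw [← Finset.sum_div, Finset.sum_add_distrib, pow_succ]
  field_simp

theorem bitAvg_mono {n : ℕ} {f g : (Fin n → Bool) → ℝ} (h : ∀ y, f y ≤ g y) :
    bitAvg f ≤ bitAvg g := by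
  unfold bitAvg
  gcongr with y
  exact h y

theorem bitAvg_mul {n : ℕ} (a : ℝ) (f : (Fin n → Bool) → ℝ) :
    bitAvg (fun y => a * f y) = a * bitAvg f := by
  simp only [bitAvg, ← Finset.mul_sum, mul_div_assoc]

/-- A random signed sum of the coordinates of `x`. -/
def signedSum {n : ℕ} (x : Fin n → ℝ) (y : Fin n → Bool) : ℝ := ∑ w, x w * bitSign (y w)

/-- Expanding the squares, the average is `exp (l * x ^ 2 + l * X ^ 2)` times `cosh (2 * l * x *
X)`, and `cosh t ≤ exp (t ^ 2 / 2)`. The sign of `l` is arbitrary, so the inequality serves both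
tails. -/
theorem avg_exp_sq_le (l x X : ℝ) :
    (Real.exp (l * (x * 1 + X) ^ 2) + Real.exp (l * (x * (-1) + X) ^ 2)) / 2 ≤
      Real.exp (l * x ^ 2) * Real.exp ((l + 2 * l ^ 2 * x ^ 2) * X ^ 2) := by
  have h := Real.cosh_le_exp_half_sq (2 * l * x * X)
  rw [Real.cosh_eq] at h
  have e1 : l * (x * 1 + X) ^ 2 = (l * x ^ 2 + l * X ^ 2) + 2 * l * x * X := by ring
  have e2 : l * (x * (-1) + X) ^ 2 = (l * x ^ 2 + l * X ^ 2) + -(2 * l * x * X) := by ring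
  have e3 : l * x ^ 2 + (l + 2 * l ^ 2 * x ^ 2) * X ^ 2 =
      (l * x ^ 2 + l * X ^ 2) + (2 * l * x * X) ^ 2 / 2 := by ring
  rw [← Real.exp_add, e1, e2, e3, Real.exp_add, Real.exp_add _ (-_), Real.exp_add _ (_ / 2)]
  have := mul_le_mul_of_nonneg_left h (Real.exp_pos (l * x ^ 2 + l * X ^ 2)).le
  linarith

theorem signedSum_cons {n : ℕ} (x : Fin (n + 1) → ℝ) (b : Bool) (y : Fin n → Bool) :
    signedSum x (Fin.cons b y) = x 0 * bitSign b + signedSum (fun i => x i.succ) y := by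
  simp [signedSum, Fin.sum_univ_succ]

theorem bitAvg_exp_succ {n : ℕ} (x : Fin (n + 1) → ℝ) (l : ℝ) :
    bitAvg (fun y => Real.exp (l * signedSum x y ^ 2)) ≤ Real.exp (l * x 0 ^ 2) *
      bitAvg fun y => Real.exp ((l + 2 * l ^ 2 * x 0 ^ 2) *
        signedSum (fun i => x i.succ) y ^ 2) := by
  rw [bitAvg_succ, ← bitAvg_mul]
  refine bitAvg_mono fun y => ?_
  simp only [signedSum_cons, bitSign]
  exact avg_exp_sq_le l (x 0) _

/-- Averaging out a coordinate turns the coefficient `l` into `l + 2 * l ^ 2 * x ^ 2`, which lowers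
`1 / l` by at most `2 * x ^ 2`. Starting from `1 / l = b + 2 * ∑ x ^ 2`, it never falls below `b`,
so each coordinate contributes a factor of at most `exp (x ^ 2 / b)`. -/
theorem bitAvg_exp_pos_le {n : ℕ} (x : Fin n → ℝ) {b : ℝ} (hb : 0 < b) :
    bitAvg (fun y => Real.exp (1 / (b + 2 * ∑ w, x w ^ 2) * signedSum x y ^ 2)) ≤
      Real.exp ((∑ w, x w ^ 2) / b) := by
  induction n with
  | zero => simp [bitAvg, signedSum]
  | succ n ih =>
    refine (bitAvg_exp_succ x _).trans ?_
    have hq : 0 ≤ ∑ i : Fin n, x i.succ ^ 2 := Finset.sum_nonneg fun i _ => sq_nonneg _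
    rw [Fin.sum_univ_succ]
    set q := ∑ i : Fin n, x i.succ ^ 2 with hqd
    have hx := sq_nonneg (x 0)
    rw [add_div, Real.exp_add]
    refine mul_le_mul (Real.exp_le_exp.2 ?_) ((bitAvg_mono fun y => Real.exp_le_exp.2 ?_).trans
      (ih fun i => x i.succ)) ?_ (Real.exp_pos _).le
    · rw [one_div, inv_mul_eq_div]
      gcongr
      linarith
    · refine mul_le_mul_of_nonneg_right ?_ (sq_nonneg _)
      rw [← hqd]
      have h1 : 0 < b + 2 * (x 0 ^ 2 + q) := by positivity
      have h2 : 0 < b + 2 * q := by positivity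
      rw [div_add' _ _ _ h1.ne', div_le_div_iff₀ h1 h2]
      field_simp
      nlinarith [sq_nonneg (x 0 ^ 2)]
    · unfold bitAvg; positivity

/-- The same recursion for `l = -1 / b`: the new coefficient is at most `-1 / (b + 4 * x ^ 2)`,
provided that `4 * x ^ 2 ≤ b`. The parameter `b` only grows, so this condition survives the
induction. -/
theorem bitAvg_exp_neg_le {n : ℕ} (x : Fin n → ℝ) {b : ℝ} (hb : 0 < b)
    (hx : ∀ w, 4 * x w ^ 2 ≤ b) :
    bitAvg (fun y => Real.exp (-(1 / b) * signedSum x y ^ 2)) ≤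
      Real.exp (-((∑ w, x w ^ 2) / (b + 4 * ∑ w, x w ^ 2))) := by
  induction n generalizing b with
  | zero => simp [bitAvg, signedSum]
  | succ n ih =>
    refine (bitAvg_exp_succ x _).trans ?_
    have hq : 0 ≤ ∑ i : Fin n, x i.succ ^ 2 := Finset.sum_nonneg fun i _ => sq_nonneg _
    have hb' : 0 < b + 4 * x 0 ^ 2 := by positivity
    have ih' := ih (fun i => x i.succ) hb' fun w => by linarith [hx w.succ, sq_nonneg (x 0)]
    rw [Fin.sum_univ_succ]
    set q := ∑ i : Fin n, x i.succ ^ 2 with hqd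
    have hx0 := sq_nonneg (x 0)
    have e : -((x 0 ^ 2 + q) / (b + 4 * (x 0 ^ 2 + q))) =
        -(x 0 ^ 2 / (b + 4 * (x 0 ^ 2 + q))) + -(q / (b + 4 * x 0 ^ 2 + 4 * q)) := by
      rw [add_div, neg_add]; ring_nf
    rw [e, Real.exp_add]
    refine mul_le_mul (Real.exp_le_exp.2 ?_) ((bitAvg_mono fun y => Real.exp_le_exp.2 ?_).trans
      ih') ?_ (Real.exp_pos _).le
    · rw [neg_mul, neg_le_neg_iff, one_div, inv_mul_eq_div]
      gcongr
      linarith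
    · refine mul_le_mul_of_nonneg_right ?_ (sq_nonneg _)
      have h := hx 0
      rw [← sub_nonneg]
      have : -(1 / (b + 4 * x 0 ^ 2)) - (-(1 / b) + 2 * (-(1 / b)) ^ 2 * x 0 ^ 2) =
        2 * x 0 ^ 2 * (b - 4 * x 0 ^ 2) / (b ^ 2 * (b + 4 * x 0 ^ 2)) := by
        field_simp; ring
      rw [this]
      have : 0 ≤ b - 4 * x 0 ^ 2 := by linarith
      positivity
    · unfold bitAvg; positivity

/-- Markov's inequality for exponential moments of sums over independent columns. -/
theorem card_le_of_bitAvg_exp {n m : ℕ} (g : (Fin n → Bool) → ℝ) {A B : ℝ}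
    (hg : bitAvg (fun y => Real.exp (g y)) ≤ Real.exp A)
    (s : Finset (Fin m → Fin n → Bool)) (hs : ∀ y ∈ s, m * B ≤ ∑ j, g (y j)) :
    (s.card : ℝ) ≤ Real.exp (m * (A - B)) * 2 ^ (m * n) := by
  have h1 : ∑ y : Fin m → Fin n → Bool, Real.exp (∑ j, g (y j)) ≤
      Real.exp (m * A) * 2 ^ (m * n) := by
    have : ∑ y : Fin m → Fin n → Bool, Real.exp (∑ j, g (y j)) =
        (bitAvg (fun y => Real.exp (g y)) * 2 ^ n) ^ m := by
      simp only [Real.exp_sum, bitAvg]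
      rw [div_mul_cancel₀ _ (by positivity)]
      have := (Finset.prod_univ_sum (fun _ : Fin m => (Finset.univ : Finset (Fin n → Bool)))
        fun _ y => Real.exp (g y))
      rw [Finset.prod_const, Finset.card_univ, Fintype.card_fin] at this
      rw [this, Fintype.piFinset_univ]
    rw [this, mul_pow, ← pow_mul, mul_comm n m, Real.exp_nat_mul]
    gcongr
    unfold bitAvg
    positivity
  have h2 : (s.card : ℝ) * Real.exp (m * B) ≤
      ∑ y : Fin m → Fin n → Bool, Real.exp (∑ j, g (y j)) := by
    rw [← nsmul_eq_mul]
    refine (Finset.card_nsmul_le_sum s _ _ fun y hy => Real.exp_le_exp.2 (hs y hy)).trans ?_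
    exact Finset.sum_le_univ_sum_of_nonneg fun y => (Real.exp_pos _).le
  have h3 := h2.trans h1
  rw [mul_sub, Real.exp_sub, div_mul_eq_mul_div, le_div_iff₀ (Real.exp_pos _)]
  exact h3

open Classical in
/-- The second moment sketch of a vector with entries in `[-1, 1]` is accurate up to a factor `4`
outside an exponentially small set of sign patterns. -/
theorem card_bad_sketch_le {n m : ℕ} (x : Fin n → ℝ) :
    ((Finset.univ.filter fun y : Fin m → Fin n → Bool =>
      ¬ (m * ∑ w, x w ^ 2 ≤ 4 * ∑ j, signedSum x (y j) ^ 2 ∧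
        ∑ j, signedSum x (y j) ^ 2 ≤ 4 * m * ∑ w, x w ^ 2)).card : ℝ) ≤
      2 * Real.exp (-(m / 16)) * 2 ^ (m * n) := by
  set q := ∑ w, x w ^ 2 with hq
  have hq0 : 0 ≤ q := Finset.sum_nonneg fun i _ => sq_nonneg _
  rcases hq0.eq_or_lt with h0 | hpos
  · have hz : ∀ w, x w = 0 := fun w => by
      have := (Finset.sum_eq_zero_iff_of_nonneg (fun i _ => sq_nonneg (x i))).1 h0.symm w
        (Finset.mem_univ w)
      simpa using this
    have : ∀ y, signedSum x y = 0 := fun y => by simp [signedSum, hz]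
    simp only [this, ← h0]
    simp
    positivity
  · have hle : ∀ w, 4 * x w ^ 2 ≤ 4 * q := fun w => by
      have := Finset.single_le_sum (fun i _ => sq_nonneg (x i)) (Finset.mem_univ w)
      linarith
    -- These parameters give the moments `exp (1 / 2)` and `exp (-1 / 8)` for the coefficients `1 /
    -- (4 * q)` and `-1 / (4 * q)`. The bad events force an average exponent of at least `1` and `-1
    -- / 16`, which leaves the rates `1 / 2` and `1 / 16`.
    have hU := bitAvg_exp_pos_le x (b := 2 * q) (by positivity)
    have hL := bitAvg_exp_neg_le x (b := 4 * q) (by positivity) hle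
    rw [← hq] at hU hL
    have eU : q / (2 * q) = 1 / 2 := by field_simp
    have eL : -(q / (4 * q + 4 * q)) = -(1 / 8) := by field_simp; norm_num
    rw [eU] at hU
    rw [eL] at hL
    have cU := card_le_of_bitAvg_exp (m := m) _ (B := 1) hU
      (Finset.univ.filter fun y => 4 * m * q < ∑ j, signedSum x (y j) ^ 2) (by
        intro y hy
        have := (Finset.mem_filter.1 hy).2
        rw [← Finset.mul_sum, one_div, inv_mul_eq_div, le_div_iff₀ (by positivity)]
        linarith)
    have cL := card_le_of_bitAvg_exp (m := m) _ (B := -(1 / 16)) hL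
      (Finset.univ.filter fun y => 4 * ∑ j, signedSum x (y j) ^ 2 < m * q) (by
        intro y hy
        have := (Finset.mem_filter.1 hy).2
        rw [← Finset.mul_sum, neg_mul, mul_neg, neg_le_neg_iff, one_div, inv_mul_eq_div,
          div_le_iff₀ (by positivity)]
        linarith)
    have hsub : (Finset.univ.filter fun y : Fin m → Fin n → Bool =>
      ¬ (m * q ≤ 4 * ∑ j, signedSum x (y j) ^ 2 ∧
        ∑ j, signedSum x (y j) ^ 2 ≤ 4 * m * q)) ⊆
        (Finset.univ.filter fun y => 4 * ∑ j, signedSum x (y j) ^ 2 < m * q) ∪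
        (Finset.univ.filter fun y => 4 * m * q < ∑ j, signedSum x (y j) ^ 2) := by
      intro y hy
      simp only [Finset.mem_filter, Finset.mem_union, Finset.mem_univ, true_and] at hy ⊢
      by_contra! h
      exact hy ⟨h.1, h.2⟩
    have hc : _ ≤ (_ : ℝ) := Nat.cast_le.2 ((Finset.card_le_card hsub).trans
      (Finset.card_union_le _ _))
    push_cast at hc
    have e1 : Real.exp (m * (1 / 2 - 1)) ≤ Real.exp (-(m / 16 : ℝ)) := by
      apply Real.exp_le_exp.2
      have : (0 : ℝ) ≤ m := Nat.cast_nonneg m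
      linarith
    have e2 : Real.exp (m * (-(1 / 8) - -(1 / 16))) = Real.exp (-(m / 16 : ℝ)) := by
      congr 1; ring
    rw [e2] at cL
    have := mul_le_mul_of_nonneg_right e1 (by positivity : (0 : ℝ) ≤ 2 ^ (m * n))
    linarith

/-! ### The surrogate cost is within a constant factor of the cost -/

section Combinatorics

/-- The vertices whose estimated distance from `u` is small on the scale `s`. -/
def nearBall {V : Type*} [Fintype V] (T : V → V → ℕ) (m : ℕ) (u : V) (s : ℕ) : Finset V :=
  Finset.univ.filter fun w => 16 * T u w < m * s

theorem mem_nearBall {V : Type*} [Fintype V] {T : V → V → ℕ} {m : ℕ} {u w : V} {s : ℕ} :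
    w ∈ nearBall T m u s ↔ 16 * T u w < m * s := by
  simp [nearBall]

variable {V : Type*} [DecidableEq V]

theorem card_symmDiff_triangle (A B C : Finset V) :
    (A ∆ C).card ≤ (A ∆ B).card + (B ∆ C).card :=
  (Finset.card_le_card (symmDiff_triangle A B C)).trans (Finset.card_union_le _ _)

variable [Fintype V]

/-- The estimated cost of the clustering whose clusters are named by `p`; a name is a center and
a scale. -/
def surrogate (T : V → V → ℕ) (E : V → ℕ → ℕ) (m : ℕ) (p : V → V × ℕ) : ℕ :=
  ∑ v, (T v (p v).1 + E (p v).1 (p v).2 +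
    m * (nearBall T m (p v).1 (p v).2 ∆ Finset.univ.filter fun w => p w = p v).card)

/-- `T` and `E` are `4`-approximations, scaled by `m`, to the distances between neighborhoods
and between neighborhoods and balls. -/
structure IsAccurate (N : V → Finset V) (T : V → V → ℕ) (E : V → ℕ → ℕ) (m : ℕ) : Prop where
  dist_lower : ∀ u v, m * (N u ∆ N v).card ≤ 4 * T u v
  dist_upper : ∀ u v, T u v ≤ 4 * m * (N u ∆ N v).card
  ball_lower : ∀ u, ∀ s ≤ Fintype.card V, m * (N u ∆ nearBall T m u s).card ≤ 4 * E u s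
  ball_upper : ∀ u, ∀ s ≤ Fintype.card V, E u s ≤ 4 * m * (N u ∆ nearBall T m u s).card

variable {N : V → Finset V} {T : V → V → ℕ} {E : V → ℕ → ℕ} {m : ℕ}

/-- Triangle inequality along `N v`, the neighborhood of the center, the ball, the cluster. The
first two legs are estimated up to a factor `4`; the last one is exact. -/
theorem IsAccurate.cost_le_surrogate (h : IsAccurate N T E m) (p : V → V × ℕ)
    (hp : ∀ v, (p v).2 ≤ Fintype.card V) :
    m * ∑ v, (N v ∆ Finset.univ.filter fun w => p w = p v).card ≤ 4 * surrogate T E m p := by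
  unfold surrogate
  rw [Finset.mul_sum, Finset.mul_sum]
  refine Finset.sum_le_sum fun v _ => ?_
  have h1 := h.dist_lower v (p v).1
  have h2 := h.ball_lower (p v).1 (p v).2 (hp v)
  have h3 := (card_symmDiff_triangle (N v) (N (p v).1)
    (Finset.univ.filter fun w => p w = p v)).trans (Nat.add_le_add_left
      (card_symmDiff_triangle _ (nearBall T m (p v).1 (p v).2) _) _)
  have h4 := Nat.mul_le_mul_left m h3
  rw [mul_add, mul_add] at h4
  have h5 := Nat.zero_le
    (m * (nearBall T m (p v).1 (p v).2 ∆ Finset.univ.filter fun w => p w = p v).card)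
  linarith

/-- The minimality of `u` gives `k * r ≤ R` for `r = |N u ∆ K|`, hence `r ≤ k / 4`. Every quantity
attached to `u` is counted `k` times in the sum, so it suffices to bound `k` times the distance
between `K` and the ball of scale `k` by a multiple of `R`. -/
theorem IsAccurate.good_cluster (h : IsAccurate N T E m) (hsymm : ∀ u v, u ∈ N v ↔ v ∈ N u)
    (K : Finset V) (hR : 4 * ∑ v ∈ K, (N v ∆ K).card ≤ K.card ^ 2) {u : V} (hu : u ∈ K)
    (hmin : ∀ v ∈ K, (N u ∆ K).card ≤ (N v ∆ K).card) :
    ∑ v ∈ K, (T v u + E u K.card + m * (nearBall T m u K.card ∆ K).card) ≤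
      700 * m * ∑ v ∈ K, (N v ∆ K).card := by
  set R := ∑ v ∈ K, (N v ∆ K).card with hRd
  set k := K.card with hk
  set r := (N u ∆ K).card with hr
  set B := nearBall T m u k with hB
  have hk0 : 0 < k := Finset.card_pos.2 ⟨u, hu⟩
  have hrk : k * r ≤ R := by
    rw [← smul_eq_mul]
    exact Finset.card_nsmul_le_sum _ _ _ hmin
  have hr4 : 4 * r ≤ k := by
    have : k * (4 * r) ≤ k * k := by nlinarith
    exact Nat.le_of_mul_le_mul_left this hk0
  have hDK : ∀ v, (N v ∆ N u).card ≤ (N v ∆ K).card + r := fun v => by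
    have := card_symmDiff_triangle (N v) K (N u)
    rwa [symmDiff_comm K, ← hr] at this
  have hsumD : ∑ v ∈ K, (N v ∆ N u).card ≤ 2 * R := by
    refine (Finset.sum_le_sum fun v _ => hDK v).trans ?_
    rw [Finset.sum_add_distrib, Finset.sum_const, smul_eq_mul, ← hk, ← hRd]
    linarith
  have hT : ∑ v ∈ K, T v u ≤ 8 * (m * R) := by
    refine (Finset.sum_le_sum fun v _ => h.dist_upper v u).trans ?_
    rw [← Finset.mul_sum]
    have := Nat.mul_le_mul_left (4 * m) hsumD
    linarith
  by_cases hm : m = 0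
  · subst hm
    have hE : E u k = 0 := by simpa using h.ball_upper u k (Finset.card_le_univ _)
    simpa [hE] using hT
  have hm0 : 0 < m := Nat.pos_of_ne_zero hm
  -- A member of `K` outside the ball has a neighborhood at distance at least `k / 64` from `N u`,
  -- and these distances add up to at most `2 * R`.
  have hKB : k * (K \ B).card ≤ 128 * R := by
    have h1 : ∀ v ∈ K \ B, k ≤ 64 * (N v ∆ N u).card := fun v hv => by
      have hv' : ¬ 16 * T u v < m * k := fun hlt =>
        (Finset.mem_sdiff.1 hv).2 (Finset.mem_filter.2 ⟨Finset.mem_univ _, hlt⟩)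
      have h2 := h.dist_upper u v
      rw [symmDiff_comm] at h2
      have : m * k ≤ m * (64 * (N v ∆ N u).card) := by linarith
      exact Nat.le_of_mul_le_mul_left this hm0
    have h2 := Finset.card_nsmul_le_sum _ _ _ h1
    rw [smul_eq_mul, ← Finset.mul_sum] at h2
    have h3 : ∑ v ∈ K \ B, (N v ∆ N u).card ≤ ∑ v ∈ K, (N v ∆ N u).card :=
      Finset.sum_le_sum_of_subset Finset.sdiff_subset
    rw [mul_comm]
    linarith
  -- For `w` in the ball, `N w` is at distance less than `k / 4` from `N u`, which misses at most `k
  -- / 4` of `K`. So `w` has at least `k / 2` neighbors in `K`; if `w ∉ K`, by symmetry each of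
  -- these pairs is counted in `R`.
  have hBK : k * (B \ K).card ≤ 2 * R := by
    have h1 : ∀ w ∈ B \ K, k ≤ 2 * (N w ∩ K).card := fun w hw => by
      have hw' : 16 * T u w < m * k := (Finset.mem_filter.1 (Finset.mem_sdiff.1 hw).1).2
      have h2 := h.dist_lower u w
      have h3 : m * (4 * (N u ∆ N w).card) < m * k := by linarith
      have h4 := Nat.lt_of_mul_lt_mul_left h3
      have hsub : K ⊆ (N w ∩ K) ∪ ((N u ∆ K) ∪ (N u ∆ N w)) := fun x hx => by
        simp only [Finset.mem_union, Finset.mem_inter, Finset.mem_symmDiff]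
        tauto
      have h5 := Finset.card_le_card hsub
      have h6 := Finset.card_union_le (N w ∩ K) ((N u ∆ K) ∪ (N u ∆ N w))
      have h7 := Finset.card_union_le (N u ∆ K) (N u ∆ N w)
      omega
    have h2 := Finset.card_nsmul_le_sum _ _ _ h1
    rw [smul_eq_mul, ← Finset.mul_sum] at h2
    have h3 : ∑ w ∈ B \ K, (N w ∩ K).card = ∑ v ∈ K, (N v ∩ (B \ K)).card := by
      have := Finset.sum_card_bipartiteAbove_eq_sum_card_bipartiteBelow
        (s := B \ K) (t := K) fun w v => v ∈ N w
      simp only [Finset.bipartiteAbove, Finset.bipartiteBelow] at this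
      convert this using 3 with w _ v _
      · ext x; simp [and_comm]
      · ext x; simp only [Finset.mem_inter, Finset.mem_filter, hsymm x v, and_comm]
    have h4 : ∑ v ∈ K, (N v ∩ (B \ K)).card ≤ R := by
      refine Finset.sum_le_sum fun v _ => Finset.card_le_card fun x hx => ?_
      simp only [Finset.mem_inter, Finset.mem_sdiff, Finset.mem_symmDiff] at hx ⊢
      tauto
    rw [mul_comm]
    linarith
  have hsd : k * (B ∆ K).card ≤ 130 * R := by
    have := Finset.card_union_le (B \ K) (K \ B)
    have h2 : k * (B ∆ K).card ≤ k * ((B \ K).card + (K \ B).card) :=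
      Nat.mul_le_mul_left _ this
    linarith
  have hE : k * E u k ≤ 524 * (m * R) := by
    have h1 := h.ball_upper u k (Finset.card_le_univ _)
    have h2 := card_symmDiff_triangle (N u) K B
    rw [symmDiff_comm K B] at h2
    have h3 : k * (N u ∆ B).card ≤ 131 * R := by
      have := Nat.mul_le_mul_left k h2
      linarith
    have h4 := Nat.mul_le_mul_left k h1
    have h5 := Nat.mul_le_mul_left (4 * m) h3
    linarith
  -- The three parts contribute `8`, `524` and `130` times `m * R`, and `662 ≤ 700`.
  rw [Finset.sum_add_distrib, Finset.sum_add_distrib, Finset.sum_const, Finset.sum_const,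
    smul_eq_mul, smul_eq_mul, ← hk]
  have := Nat.mul_le_mul_left m hsd
  have h0 := Nat.zero_le (m * R)
  linarith

/-- A ball of scale `0` is empty, so the singleton of `v` has a surrogate of at most `4 * m * |N v|
+ m`. Over `K` this is at most `4 * m * R + 5 * m * |K| ^ 2`, and the hypothesis pays for the
square. -/
theorem IsAccurate.bad_cluster (h : IsAccurate N T E m)
    (K : Finset V) (hR : K.card ^ 2 ≤ 4 * ∑ v ∈ K, (N v ∆ K).card) :
    ∑ v ∈ K, (T v v + E v 0 + m * (nearBall T m v 0 ∆ {v}).card) ≤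
      700 * m * ∑ v ∈ K, (N v ∆ K).card := by
  have h1 : ∀ v ∈ K, T v v + E v 0 + m * (nearBall T m v 0 ∆ {v}).card ≤
      4 * m * (N v ∆ K).card + 5 * m * K.card := fun v hv => by
    have hT := h.dist_upper v v
    have hE := h.ball_upper v 0 (Nat.zero_le _)
    have hB : nearBall T m v 0 = ∅ := by simp [nearBall]
    rw [symmDiff_self, Finset.bot_eq_empty, Finset.card_empty, mul_zero] at hT
    rw [hB] at hE ⊢
    have h3 := card_symmDiff_triangle (N v) K ∅
    have h4 : K ∆ ∅ = K := symmDiff_bot K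
    have h5 : (∅ : Finset V) ∆ {v} = {v} := bot_symmDiff _
    rw [h4] at h3
    rw [h5, Finset.card_singleton]
    have hK : 1 ≤ K.card := Finset.card_pos.2 ⟨v, hv⟩
    have := Nat.mul_le_mul_left (4 * m) h3
    have := Nat.mul_le_mul_left m hK
    linarith
  refine (Finset.sum_le_sum h1).trans ?_
  rw [Finset.sum_add_distrib, ← Finset.mul_sum, Finset.sum_const, smul_eq_mul]
  have := Nat.mul_le_mul_left m hR
  have h0 := Nat.zero_le (m * ∑ v ∈ K, (N v ∆ K).card)
  nlinarith

-- Good clusters keep their shape and are named by their best member and their size; bad clusters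
-- are split into singletons of scale `0`. No two of the new clusters share a name: the size of a
-- good cluster is positive, and equal names of good clusters share a center, which lies in both
-- clusters. The costs are then compared one old cluster at a time.
open Classical in
theorem IsAccurate.exists_surrogate_le (h : IsAccurate N T E m)
    (hsymm : ∀ u v, u ∈ N v ↔ v ∈ N u) (C : Setoid V) :
    ∃ p : V → V × ℕ, (∀ v, (p v).2 ≤ Fintype.card V) ∧
      surrogate T E m p ≤ 700 * m * ∑ v, (N v ∆ Finset.univ.filter fun w => C w v).card := by
  set K : V → Finset V := fun v => Finset.univ.filter fun w => C w v with hK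
  have hmem : ∀ v w, w ∈ K v ↔ C w v := fun v w => by simp [hK]
  have hself : ∀ v, v ∈ K v := fun v => (hmem v v).2 (C.refl v)
  have hKeq : ∀ v w, w ∈ K v ↔ K w = K v := fun v w => by
    refine ⟨fun hw => Finset.ext fun x => ?_, fun hw => hw ▸ hself w⟩
    rw [hmem] at hw
    rw [hmem, hmem]
    exact ⟨fun hx => C.trans hx hw, fun hx => C.trans hx (C.symm hw)⟩
  have hpick : ∀ A : {A : Finset V // A.Nonempty}, ∃ u, u ∈ A.1 ∧
      ∀ v ∈ A.1, (N u ∆ A.1).card ≤ (N v ∆ A.1).card := fun A =>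
    A.1.exists_min_image (fun v => (N v ∆ A.1).card) A.2
  choose pick hpick hmin using hpick
  have hne : ∀ v, (K v).Nonempty := fun v => ⟨v, hself v⟩
  set good : Finset V → Prop := fun A => 4 * ∑ v ∈ A, (N v ∆ A).card ≤ A.card ^ 2 with hgood
  set p : V → V × ℕ := fun v =>
    if good (K v) then (pick ⟨K v, hne v⟩, (K v).card) else (v, 0) with hp
  have hpick_congr : ∀ v w, K w = K v → pick ⟨K w, hne w⟩ = pick ⟨K v, hne v⟩ := fun v w hvw => by
    simp only [hvw]
  have hclass_good : ∀ v, good (K v) → (Finset.univ.filter fun w => p w = p v) = K v :=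
    fun v hv => by
      ext w
      rw [Finset.mem_filter, hKeq]
      simp only [Finset.mem_univ, true_and, hp, if_pos hv]
      refine ⟨fun hw => ?_, fun hw => by rw [hpick_congr v w hw, hw, if_pos hv]⟩
      split_ifs at hw with hgw
      · have h1 := hpick ⟨K w, hne w⟩
        have h2 := hpick ⟨K v, hne v⟩
        rw [show pick ⟨K w, hne w⟩ = pick ⟨K v, hne v⟩ from (Prod.ext_iff.1 hw).1] at h1
        rw [← (hKeq _ _).1 h1, (hKeq _ _).1 h2]
      · have := (Prod.ext_iff.1 hw).2
        exact absurd this.symm (Finset.card_pos.2 (hne v)).ne'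
  have hclass_bad : ∀ v, ¬ good (K v) → (Finset.univ.filter fun w => p w = p v) = {v} :=
    fun v hv => by
      ext w
      rw [Finset.mem_filter, Finset.mem_singleton]
      simp only [Finset.mem_univ, true_and, hp, if_neg hv]
      refine ⟨fun hw => ?_, fun hw => by rw [hw, if_neg hv]⟩
      split_ifs at hw with hgw
      · exact absurd (Prod.ext_iff.1 hw).2 (Finset.card_pos.2 (hne w)).ne'
      · exact (Prod.ext_iff.1 hw).1
  refine ⟨p, fun v => ?_, ?_⟩
  · simp only [hp]
    split_ifs
    · exact Finset.card_le_univ _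
    · exact Nat.zero_le _
  · unfold surrogate
    rw [← Finset.sum_fiberwise _ K, ← Finset.sum_fiberwise Finset.univ K fun v => (N v ∆ K v).card,
      Finset.mul_sum]
    refine Finset.sum_le_sum fun A _ => ?_
    by_cases hA : ∃ x, K x = A
    · obtain ⟨x, rfl⟩ := hA
      have hfib : (Finset.univ.filter fun w => K w = K x) = K x := by
        ext w; rw [Finset.mem_filter, hKeq]; simp
      rw [hfib]
      have hR : ∑ v ∈ K x, (N v ∆ K v).card = ∑ v ∈ K x, (N v ∆ K x).card :=
        Finset.sum_congr rfl fun v hv => by rw [(hKeq _ _).1 hv]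
      rw [hR]
      by_cases hx : good (K x)
      · refine le_trans (le_of_eq (Finset.sum_congr rfl fun v hv => ?_))
          (h.good_cluster hsymm (K x) hx (hpick ⟨K x, hne x⟩) (hmin ⟨K x, hne x⟩))
        have hv' := (hKeq _ _).1 hv
        rw [hclass_good v (hv' ▸ hx)]
        have : p v = (pick ⟨K x, hne x⟩, (K x).card) := by
          simp only [hp]
          rw [hpick_congr x v hv', hv', if_pos hx]
        rw [this, hv']
      · refine le_trans (le_of_eq (Finset.sum_congr rfl fun v hv => ?_))
          (h.bad_cluster (K x) (not_le.1 hx).le)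
        have hv' : ¬ good (K v) := (hKeq _ _).1 hv ▸ hx
        rw [hclass_bad v hv']
        simp only [hp, if_neg hv']
    · rw [Finset.filter_false_of_mem fun v _ hv => hA ⟨v, hv⟩]
      simp

end Combinatorics

/-! ### The cost of a clustering as a sum of set distances -/

theorem two_mul_sum_edgeFinset_top {n : ℕ} (f : Sym2 (Fin n) → ℕ) :
    2 * ∑ e ∈ (⊤ : SimpleGraph (Fin n)).edgeFinset, f e =
      ∑ v, ∑ w ∈ Finset.univ.filter fun w => w ≠ v, f s(v, w) := by
  have h1 : (⊤ : SimpleGraph (Fin n)).edgeFinset =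
      (Finset.univ : Finset (Fin n)).sym2.filter fun e => ¬ e.IsDiag := by
    ext e; simp
  rw [h1, Finset.sum_sym2_filter_not_isDiag]
  have h2 : ∑ v, ∑ w ∈ Finset.univ.filter fun w => w ≠ v, f s(v, w) =
      ∑ i ∈ (Finset.univ : Finset (Fin n)).offDiag, f s(i.1, i.2) := by
    rw [Finset.sum_sigma']
    refine Finset.sum_bij' (fun x _ => (x.1, x.2)) (fun x _ => ⟨x.1, x.2⟩) ?_ ?_ ?_ ?_ ?_ <;>
      simp [eq_comm]
  rw [h2, ← Finset.sum_filter_add_sum_filter_not Finset.univ.offDiag (fun i => i.1 < i.2),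
    two_mul]
  congr 1
  refine Finset.sum_bij' (fun x _ => (x.2, x.1)) (fun x _ => (x.2, x.1)) ?_ ?_ ?_ ?_ ?_
  · simp only [Finset.mem_filter, Finset.mem_offDiag, Finset.mem_univ, true_and, and_imp]
    intro a h h'
    exact ⟨h.symm, not_lt.2 h'.le⟩
  · simp only [Finset.mem_filter, Finset.mem_offDiag, Finset.mem_univ, true_and, and_imp]
    intro a h h'
    exact ⟨h.symm, lt_of_le_of_ne (not_lt.1 h') h.symm⟩
  · simp
  · simp
  · intro a _
    simp [Sym2.eq_swap]

open Classical in
/-- The closed neighborhood of `v` in the graph of the `(+)`-edges. -/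
noncomputable def LabeledGraph.posNbhd {V : Type*} [Fintype V] (G : LabeledGraph V) (v : V) :
    Finset V :=
  Finset.univ.filter fun w => ¬ G.neg.Adj v w

open Classical in
/-- The cost of a clustering in terms of the distances of neighborhoods and clusters. -/
theorem LabeledGraph.two_mul_cost {n : ℕ} (G : LabeledGraph (Fin n)) (C : Setoid (Fin n)) :
    2 * G.cost C = ∑ v, (G.posNbhd v ∆ Finset.univ.filter fun w => C w v).card := by
  unfold LabeledGraph.cost
  rw [two_mul_sum_edgeFinset_top]
  refine Finset.sum_congr rfl fun v _ => ?_
  rw [Finset.card_eq_sum_ones, ← Finset.sum_filter_add_sum_filter_not _ (fun w => w ≠ v)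
    (f := fun _ => 1)]
  have h0 : ((G.posNbhd v ∆ Finset.univ.filter fun w => C w v).filter fun w => ¬ w ≠ v) = ∅ := by
    ext w
    simp only [ne_eq, not_not, Finset.mem_filter, Finset.notMem_empty, iff_false, not_and]
    rintro h rfl
    simp [posNbhd, Finset.mem_symmDiff] at h
  rw [h0, Finset.sum_empty, add_zero]
  have : ∀ w, w ≠ v → G.edgeCost C s(v, w) =
      if w ∈ G.posNbhd v ∆ Finset.univ.filter fun w => C w v then 1 else 0 := fun w hw => by
    have ht : Together C s(v, w) ↔ C w v := by
      simp only [Together, Sym2.fromRel_prop]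
      exact ⟨fun h => C.symm h, fun h => C.symm h⟩
    have hN : w ∈ G.posNbhd v ↔ G.label s(v, w) = 1 := by
      have : G.neg.Adj v w ↔ G.label s(v, w) = -1 := by
        simp [neg, hw.symm]
      simp only [posNbhd, Finset.mem_filter, Finset.mem_univ, true_and, this]
      rcases Int.units_eq_one_or (G.label s(v, w)) with h | h <;> simp [h]
    simp only [edgeCost, Finset.mem_symmDiff, Finset.mem_filter, hN, ht]
    rcases Int.units_eq_one_or (G.label s(v, w)) with h | h <;> simp [h]
  rw [Finset.sum_congr rfl fun w hw => this w (Finset.mem_filter.1 hw).2]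
  rw [← Finset.sum_filter]
  exact Finset.sum_congr (by ext w; simp [and_comm]) fun _ _ => rfl

/-! ### From counting sign patterns to the coin tape -/

/-- The difference of two indicator vectors. -/
def diffVec {n : ℕ} (A B : Finset (Fin n)) (w : Fin n) : ℝ :=
  (if w ∈ A then 1 else 0) - if w ∈ B then 1 else 0

theorem sum_diffVec_sq {n : ℕ} (A B : Finset (Fin n)) :
    ∑ w, diffVec A B w ^ 2 = (A ∆ B).card := by
  have : ∀ w, diffVec A B w ^ 2 = if w ∈ A ∆ B then 1 else 0 := fun w => by
    simp only [diffVec, Finset.mem_symmDiff]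
    by_cases hA : w ∈ A <;> by_cases hB : w ∈ B <;> simp [hA, hB]
  simp [this]

/-- The columns `j * n, …, j * n + n - 1` of a coin tape for `k ≤ j < k + m`. -/
def tapeBlock (n m k : ℕ) (ω : ℕ → Bool) (j : Fin m) (w : Fin n) : Bool :=
  ω ((k + j) * n + w)

theorem coinTape_cylinder (ω₀ : ℕ → Bool) (M : ℕ) :
    StreamRAM.coinTape {ω | ∀ i < M, ω i = ω₀ i} = 2⁻¹ ^ M := by
  have h := Measure.infinitePi_pi (fun _ : ℕ => (PMF.uniformOfFintype Bool).toMeasure)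
    (s := Finset.range M) (t := fun i => {ω₀ i}) fun i _ => measurableSet_singleton _
  have e : {ω : ℕ → Bool | ∀ i < M, ω i = ω₀ i} =
      Set.pi (Finset.range M) fun i => {ω₀ i} := by
    ext ω; simp [Set.mem_pi]
  rw [StreamRAM.coinTape, e, h]
  simp

/-- The two blocks together are the first `2 * m * n` coins, so each value of the pair is attained
on a single cylinder, or nowhere. -/
theorem coinTape_blocks_le {n m : ℕ}
    (S : Finset ((Fin m → Fin n → Bool) × (Fin m → Fin n → Bool))) :
    StreamRAM.coinTape {ω | (tapeBlock n m 0 ω, tapeBlock n m m ω) ∈ S} ≤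
      S.card * 2⁻¹ ^ (2 * m * n) := by
  have h1 : {ω | (tapeBlock n m 0 ω, tapeBlock n m m ω) ∈ S} ⊆
      ⋃ x ∈ S, {ω | (tapeBlock n m 0 ω, tapeBlock n m m ω) = x} := fun ω hω => by
    simpa using hω
  refine (measure_mono h1).trans ((measure_biUnion_finset_le _ _).trans ?_)
  rw [← nsmul_eq_mul]
  refine Finset.sum_le_card_nsmul _ _ _ fun x _ => ?_
  rcases Set.eq_empty_or_nonempty {ω | (tapeBlock n m 0 ω, tapeBlock n m m ω) = x} with h | ⟨ω₀, h⟩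
  · rw [h]; simp
  · rw [← coinTape_cylinder ω₀]
    refine measure_mono fun ω hω i hi => ?_
    have hω' := Prod.ext_iff.1 (Eq.trans hω (Eq.symm h))
    have hn : 0 < n := Nat.pos_of_ne_zero fun h0 => by simp [h0] at hi
    have hj : i / n < 2 * m := Nat.div_lt_of_lt_mul (by rwa [mul_comm n])
    have hi' : i / n * n + i % n = i := by rw [mul_comm]; exact Nat.div_add_mod i n
    by_cases hjm : i / n < m
    · have := congrFun (congrFun hω'.1 ⟨i / n, hjm⟩) ⟨i % n, Nat.mod_lt _ hn⟩
      simpa [tapeBlock, hi'] using this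
    · have := congrFun (congrFun hω'.2 ⟨i / n - m, by omega⟩) ⟨i % n, Nat.mod_lt _ hn⟩
      have e : m + (i / n - m) = i / n := by omega
      simpa [tapeBlock, e, hi'] using this

-- Union bound over `n * n` pairs of neighborhoods, measured by the first block, and over `n * (n +
-- 1)` pairs of a neighborhood and a ball, measured by the second.
open Classical in
theorem card_not_isAccurate_le {n m : ℕ} (N : Fin n → Finset (Fin n))
    (T : (Fin m → Fin n → Bool) → Fin n → Fin n → ℕ)
    (E : (Fin m → Fin n → Bool) → (Fin m → Fin n → Bool) → Fin n → ℕ → ℕ)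
    (hT : ∀ y u v, (T y u v : ℝ) = ∑ j, signedSum (diffVec (N u) (N v)) (y j) ^ 2)
    (hE : ∀ y z u s, (E y z u s : ℝ) =
      ∑ j, signedSum (diffVec (N u) (nearBall (T y) m u s)) (z j) ^ 2) :
    ((Finset.univ.filter fun x : (Fin m → Fin n → Bool) × (Fin m → Fin n → Bool) =>
      ¬ IsAccurate N (T x.1) (E x.1 x.2) m).card : ℝ) ≤
      (n * n + n * (n + 1)) * (2 * Real.exp (-(m / 16))) * 2 ^ (2 * m * n) := by
  set ok : Finset (Fin n) → Finset (Fin n) → (Fin m → Fin n → Bool) → Prop := fun A B y =>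
    (m * ∑ w, diffVec A B w ^ 2 ≤ 4 * ∑ j, signedSum (diffVec A B) (y j) ^ 2 ∧
      ∑ j, signedSum (diffVec A B) (y j) ^ 2 ≤ 4 * m * ∑ w, diffVec A B w ^ 2) with hok
  have hcount : ∀ A B, ((Finset.univ.filter fun y => ¬ ok A B y).card : ℝ) ≤
      2 * Real.exp (-(m / 16)) * 2 ^ (m * n) := fun A B => card_bad_sketch_le (diffVec A B)
  set ε := 2 * Real.exp (-(m / 16 : ℝ)) with hε
  have hcard : (Fintype.card (Fin m → Fin n → Bool) : ℝ) = 2 ^ (m * n) := by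
    simp [← pow_mul, mul_comm]
  have hsub : (Finset.univ.filter fun x : (Fin m → Fin n → Bool) × (Fin m → Fin n → Bool) =>
      ¬ IsAccurate N (T x.1) (E x.1 x.2) m) ⊆
      (Finset.univ.biUnion fun p : Fin n × Fin n =>
        Finset.univ.filter fun x => ¬ ok (N p.1) (N p.2) x.1) ∪
      (Finset.univ.biUnion fun p : Fin n × Fin (n + 1) =>
        Finset.univ.filter fun x => ¬ ok (N p.1) (nearBall (T x.1) m p.1 p.2) x.2) := by
    intro x hx
    by_contra hcon
    simp only [Finset.mem_union, Finset.mem_biUnion, Finset.mem_filter, Finset.mem_univ, true_and,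
      not_or, not_exists, not_not, Prod.forall, hok, sum_diffVec_sq, ← hT, ← hE] at hcon hx
    refine hx ⟨fun u v => ?_, fun u v => ?_, fun u s hs => ?_, fun u s hs => ?_⟩
    · exact_mod_cast (hcon.1 u v).1
    · exact_mod_cast (hcon.1 u v).2
    · rw [Fintype.card_fin] at hs
      exact_mod_cast (hcon.2 u ⟨s, Nat.lt_succ_of_le hs⟩).1
    · rw [Fintype.card_fin] at hs
      exact_mod_cast (hcon.2 u ⟨s, Nat.lt_succ_of_le hs⟩).2
  have h1 : ∀ p : Fin n × Fin n, ((Finset.univ.filter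
      fun x : (Fin m → Fin n → Bool) × (Fin m → Fin n → Bool) =>
        ¬ ok (N p.1) (N p.2) x.1).card : ℝ) ≤ ε * 2 ^ (2 * m * n) := fun p => by
    have : (Finset.univ.filter fun x : (Fin m → Fin n → Bool) × (Fin m → Fin n → Bool) =>
        ¬ ok (N p.1) (N p.2) x.1) = (Finset.univ.filter fun y => ¬ ok (N p.1) (N p.2) y) ×ˢ
          Finset.univ := by
      ext x; simp
    rw [this, Finset.card_product, Nat.cast_mul, Finset.card_univ, hcard, mul_assoc 2 m n, two_mul,
      pow_add, ← mul_assoc]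
    exact mul_le_mul_of_nonneg_right (hcount _ _) (by positivity)
  have h2 : ∀ p : Fin n × Fin (n + 1), ((Finset.univ.filter
      fun x : (Fin m → Fin n → Bool) × (Fin m → Fin n → Bool) =>
        ¬ ok (N p.1) (nearBall (T x.1) m p.1 p.2) x.2).card : ℝ) ≤ ε * 2 ^ (2 * m * n) :=
    fun p => by
    -- The first block is fixed before the second is counted: it determines the ball, to which the
    -- sketch bound applies as to any fixed set.
    have : (Finset.univ.filter fun x : (Fin m → Fin n → Bool) × (Fin m → Fin n → Bool) =>
        ¬ ok (N p.1) (nearBall (T x.1) m p.1 p.2) x.2).card = ∑ y, (Finset.univ.filter fun z =>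
          ¬ ok (N p.1) (nearBall (T y) m p.1 p.2) z).card := by
      rw [Finset.card_filter, Fintype.sum_prod_type]
      exact Finset.sum_congr rfl fun y _ => (Finset.card_filter _ _).symm
    rw [this]
    push_cast
    refine (Finset.sum_le_card_nsmul _ _ _ fun y _ => hcount _ _).trans ?_
    rw [Finset.card_univ, nsmul_eq_mul, hcard, mul_assoc 2 m n, two_mul, pow_add]
    apply le_of_eq; ring
  have hc := (Finset.card_le_card hsub).trans ((Finset.card_union_le _ _).trans
    (add_le_add Finset.card_biUnion_le Finset.card_biUnion_le))
  have hc' : (_ : ℝ) ≤ _ := Nat.cast_le.2 hc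
  push_cast at hc'
  refine hc'.trans ((add_le_add (Finset.sum_le_card_nsmul _ _ _ fun p _ => h1 p)
    (Finset.sum_le_card_nsmul _ _ _ fun p _ => h2 p)).trans (le_of_eq ?_))
  simp only [Finset.card_univ, Fintype.card_prod, Fintype.card_fin, nsmul_eq_mul]
  push_cast
  ring

/-! ### The linear sketch and the objective in natural numbers -/

section Sketch

open Classical

/-- The sum over `w < n` of `x w` on the set `A` and of `1` outside of it. -/
noncomputable def maskSum (n : ℕ) (x : ℕ → ℕ) (A : ℕ → Prop) : ℕ :=
  ∑ w ∈ Finset.range n, if A w then x w else 1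

/-- The squared distance of the columns `u` and `v` of the first `m` rows of `Y`. -/
def sketchDist (Y : ℕ → ℕ → ℕ) (m u v : ℕ) : ℕ :=
  ∑ j ∈ Finset.range m, Nat.dist (Y j u) (Y j v) ^ 2

/-- The squared distance of the sketches of the neighborhood of `u` and of the ball of scale `s`
around `u`, in the rows `m, …, 2 * m - 1`. -/
noncomputable def ballDist (X Y : ℕ → ℕ → ℕ) (n m u s : ℕ) : ℕ :=
  ∑ j ∈ Finset.range m, Nat.dist
    (maskSum n (X (m + j)) fun w => ¬ 16 * sketchDist Y m u w < m * s) (Y (m + j) u) ^ 2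

/-- The number of vertices in the symmetric difference of the cluster of `v` and the ball that
names it, scaled by `m`. -/
noncomputable def mismatch (Y : ℕ → ℕ → ℕ) (n m : ℕ) (a : ℕ → ℕ) (v : ℕ) : ℕ :=
  ∑ w ∈ Finset.range n,
    if (16 * sketchDist Y m (a v % n) w < m * (a v / n) ↔ a w = a v) then 0 else m

/-- The estimated cost of the clustering with the cluster names `a v = u + n * s`. -/
noncomputable def objective (X Y : ℕ → ℕ → ℕ) (n m : ℕ) (a : ℕ → ℕ) : ℕ :=
  ∑ v ∈ Finset.range n,
    (sketchDist Y m v (a v % n) + ballDist X Y n m (a v % n) (a v / n) + mismatch Y n m a v)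

/-- The random signs, shifted to `0` and `2`. -/
def tapeSign (n : ℕ) (ω : ℕ → Bool) (j w : ℕ) : ℕ := 2 * (ω (j * n + w)).toNat

/-- Adjacency of natural numbers as vertices of a graph on `Fin n`. -/
def natAdj {n : ℕ} (H : SimpleGraph (Fin n)) (u w : ℕ) : Prop :=
  ∃ (hu : u < n) (hw : w < n), H.Adj ⟨u, hu⟩ ⟨w, hw⟩

/-- The linear sketch of a graph. -/
noncomputable def graphSketch {n : ℕ} (H : SimpleGraph (Fin n)) (ω : ℕ → Bool) (j u : ℕ) : ℕ :=
  maskSum n (tapeSign n ω j) (natAdj H u)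

/-- The signed difference of two sets. -/
def setDiscrepancy {n : ℕ} (A B : Finset (Fin n)) (y : Fin n → Bool) : ℤ :=
  ∑ w, ((if w ∈ A then 1 else 0) - if w ∈ B then 1 else 0) * if y w then 1 else -1

theorem cast_setDiscrepancy {n : ℕ} (A B : Finset (Fin n)) (y : Fin n → Bool) :
    (((setDiscrepancy A B y).natAbs ^ 2 : ℕ) : ℝ) = signedSum (diffVec A B) y ^ 2 := by
  rw [Nat.cast_pow, Nat.cast_natAbs, Int.cast_abs, sq_abs]
  simp [setDiscrepancy, signedSum, diffVec, bitSign]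

/-- A term of `maskSum` is `1` plus the sign `±1` on the mask, and `1` off it. The shifts cancel in
the difference, and passing from the masks to their complements only flips its sign. Hence sketching
the (-)-edges measures distances of (+)-neighborhoods without negative numbers. -/
theorem dist_maskSum {n : ℕ} (ω : ℕ → Bool) (j : ℕ) {P Q : ℕ → Prop} {A B : Finset (Fin n)}
    (hA : ∀ w, w ∈ A ↔ ¬ P w) (hB : ∀ w, w ∈ B ↔ ¬ Q w) :
    Nat.dist (maskSum n (tapeSign n ω j) P) (maskSum n (tapeSign n ω j) Q) =
      (setDiscrepancy A B fun w => ω (j * n + w)).natAbs := by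
  have h1 : ∀ a b : ℕ, Nat.dist a b = ((b : ℤ) - a).natAbs := fun a b => by
    unfold Nat.dist; omega
  rw [h1]
  congr 1
  unfold maskSum setDiscrepancy
  rw [Finset.sum_range, Finset.sum_range]
  push_cast
  rw [← Finset.sum_sub_distrib]
  refine Finset.sum_congr rfl fun w _ => ?_
  by_cases h1 : P w <;> by_cases h2 : Q w <;> by_cases h3 : ω (j * n + w) = true <;>
    simp [hA, hB, h1, h2, h3, tapeSign]

variable {n : ℕ} (G : LabeledGraph (Fin n)) (ω : ℕ → Bool) (m : ℕ)

/-- The estimated distances of neighborhoods. -/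
noncomputable def nbhdEst (u v : Fin n) : ℕ := sketchDist (graphSketch G.neg ω) m u v

/-- The estimated distances of neighborhoods and balls. -/
noncomputable def ballEst (u : Fin n) (s : ℕ) : ℕ :=
  ballDist (tapeSign n ω) (graphSketch G.neg ω) n m u s

theorem mem_posNbhd (u w : Fin n) : w ∈ G.posNbhd u ↔ ¬ natAdj G.neg u w := by
  simp [LabeledGraph.posNbhd, natAdj]

theorem nbhdEst_eq (u v : Fin n) : nbhdEst G ω m u v =
    ∑ j, (setDiscrepancy (G.posNbhd u) (G.posNbhd v) (tapeBlock n m 0 ω j)).natAbs ^ 2 := by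
  unfold nbhdEst sketchDist
  rw [Finset.sum_range]
  refine Finset.sum_congr rfl fun j _ => ?_
  rw [graphSketch, graphSketch, dist_maskSum ω j (mem_posNbhd G u) (mem_posNbhd G v)]
  unfold tapeBlock
  simp only [zero_add]

theorem ballEst_eq (u : Fin n) (s : ℕ) : ballEst G ω m u s =
    ∑ j, (setDiscrepancy (G.posNbhd u) (nearBall (nbhdEst G ω m) m u s)
      (tapeBlock n m m ω j)).natAbs ^ 2 := by
  unfold ballEst ballDist
  rw [Finset.sum_range]
  refine Finset.sum_congr rfl fun j _ => ?_
  rw [Nat.dist_comm, graphSketch, dist_maskSum ω (m + j) (mem_posNbhd G u)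
    (B := nearBall (nbhdEst G ω m) m u s)]
  · rfl
  · intro w
    rw [mem_nearBall, not_not, nbhdEst]

theorem coinTape_not_isAccurate_le :
    StreamRAM.coinTape.real {ω | ¬ IsAccurate G.posNbhd (nbhdEst G ω m) (ballEst G ω m) m} ≤
      (n * n + n * (n + 1)) * (2 * Real.exp (-(m / 16))) := by
  set T : (Fin m → Fin n → Bool) → Fin n → Fin n → ℕ := fun y u v =>
    ∑ j, (setDiscrepancy (G.posNbhd u) (G.posNbhd v) (y j)).natAbs ^ 2 with hT
  set E : (Fin m → Fin n → Bool) → (Fin m → Fin n → Bool) → Fin n → ℕ → ℕ := fun y z u s =>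
    ∑ j, (setDiscrepancy (G.posNbhd u) (nearBall (T y) m u s) (z j)).natAbs ^ 2 with hE
  have h1 := card_not_isAccurate_le G.posNbhd T E
    (fun y u v => by rw [hT, Nat.cast_sum]; simp only [cast_setDiscrepancy])
    (fun y z u s => by rw [hE, Nat.cast_sum]; simp only [cast_setDiscrepancy])
  set S := Finset.univ.filter fun x : (Fin m → Fin n → Bool) × (Fin m → Fin n → Bool) =>
      ¬ IsAccurate G.posNbhd (T x.1) (E x.1 x.2) m with hS
  have h2 : {ω | ¬ IsAccurate G.posNbhd (nbhdEst G ω m) (ballEst G ω m) m} =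
      {ω | (tapeBlock n m 0 ω, tapeBlock n m m ω) ∈ S} := by
    ext ω
    have e1 : nbhdEst G ω m = T (tapeBlock n m 0 ω) := by
      ext u v; exact nbhdEst_eq G ω m u v
    have e2 : ballEst G ω m = E (tapeBlock n m 0 ω) (tapeBlock n m m ω) := by
      ext u s; rw [ballEst_eq, e1]
    simp only [Set.mem_ofPred_eq, hS, Finset.mem_filter, Finset.mem_univ, true_and, e1, e2]
  rw [h2, measureReal_def]
  have h3 := ENNReal.toReal_mono (by
    exact ENNReal.mul_ne_top (ENNReal.natCast_ne_top _) (by simp)) (coinTape_blocks_le S)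
  refine h3.trans ?_
  rw [ENNReal.toReal_mul, ENNReal.toReal_natCast, ENNReal.toReal_pow, ENNReal.toReal_inv,
    ENNReal.toReal_ofNat, inv_pow, ← div_eq_mul_inv, div_le_iff₀ (by positivity)]
  exact h1

/-- Decoding `u + n * s` into center and scale identifies the objective with the surrogate. The
factor is `2800 = 4 * 700`: `4` for the cost below the surrogate of the minimizer, `700` for the
surrogate of a naming built from the competitor. -/
theorem LabeledGraph.isApprox_of_objective_le (hn : 0 < n) (hm : 0 < m)
    (hacc : IsAccurate G.posNbhd (nbhdEst G ω m) (ballEst G ω m) m) {a : ℕ → ℕ}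
    (ha : ∀ v < n, a v < n * (n + 1))
    (hmin : ∀ b : ℕ → ℕ, (∀ v < n, b v < n * (n + 1)) →
      objective (tapeSign n ω) (graphSketch G.neg ω) n m a ≤
        objective (tapeSign n ω) (graphSketch G.neg ω) n m b) :
    G.IsApprox 2800 (Setoid.ker fun v : Fin n => a v) := by
  have hobj : ∀ (p : Fin n → Fin n × ℕ) (b : ℕ → ℕ), (∀ v : Fin n, b v = (p v).1 + n * (p v).2) →
      objective (tapeSign n ω) (graphSketch G.neg ω) n m b =
        surrogate (nbhdEst G ω m) (ballEst G ω m) m p := fun p b hb => by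
    unfold objective surrogate
    rw [Finset.sum_range]
    refine Finset.sum_congr rfl fun v _ => ?_
    have e1 : ∀ v : Fin n, b v % n = (p v).1 := fun v => by
      rw [hb, Nat.add_mul_mod_self_left, Nat.mod_eq_of_lt (p v).1.2]
    have e2 : ∀ v : Fin n, b v / n = (p v).2 := fun v => by
      rw [hb, Nat.add_mul_div_left _ _ hn, Nat.div_eq_of_lt (p v).1.2, zero_add]
    have e3 : ∀ v w : Fin n, b w = b v ↔ p w = p v := fun v w => by
      refine ⟨fun h => Prod.ext (Fin.ext ?_) ?_, fun h => by rw [hb, hb, h]⟩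
      · rw [← e1, ← e1, h]
      · rw [← e2, ← e2, h]
    rw [e1, e2]
    congr 1
    unfold mismatch
    rw [Finset.sum_range]
    have e4 : ∀ w : Fin n, (if (16 * sketchDist (graphSketch G.neg ω) m (b v % n) w <
        m * (b v / n) ↔ b w = b v) then 0 else m) =
        if w ∈ nearBall (nbhdEst G ω m) m (p v).1 (p v).2 ∆
          Finset.univ.filter fun w => p w = p v then m else 0 := fun w => by
      simp only [e1, e2, e3, Finset.mem_symmDiff, mem_nearBall, Finset.mem_filter, Finset.mem_univ, true_and,
        nbhdEst]
      by_cases h1 : 16 * sketchDist (graphSketch G.neg ω) m (p v).1 w < m * (p v).2 <;>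
        by_cases h2 : p w = p v <;> simp [h1, h2]
    rw [Finset.sum_congr rfl fun w _ => e4 w, Finset.sum_ite_mem, Finset.univ_inter,
      Finset.sum_const, smul_eq_mul, mul_comm]
  intro C'
  set p : Fin n → Fin n × ℕ := fun v => (⟨a v % n, Nat.mod_lt _ hn⟩, a v / n) with hp
  have hpa : ∀ v : Fin n, a v = (p v).1 + n * (p v).2 := fun v => (Nat.mod_add_div _ _).symm
  have hpn : ∀ v, (p v).2 ≤ Fintype.card (Fin n) := fun v => by
    rw [Fintype.card_fin]
    exact Nat.lt_succ_iff.1 (Nat.div_lt_of_lt_mul (ha v v.2))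
  have hpp : ∀ v w, p w = p v ↔ (Setoid.ker fun v : Fin n => a v) w v := fun v w => by
    rw [Setoid.ker_def]
    refine ⟨fun h => by rw [hpa, hpa, h], fun h => ?_⟩
    simp only [hp, h]
  obtain ⟨p', hp'n, hp'⟩ := hacc.exists_surrogate_le
    (fun u v => by simp only [LabeledGraph.posNbhd, Finset.mem_filter, Finset.mem_univ, true_and,
      G.neg.adj_comm]) C'
  set b : ℕ → ℕ := fun v => if h : v < n then (p' ⟨v, h⟩).1 + n * (p' ⟨v, h⟩).2 else 0 with hb
  have hb' : ∀ v : Fin n, b v = (p' v).1 + n * (p' v).2 := fun v => by simp [hb]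
  have h1 := hmin b fun v hv => by
    have h2 := hp'n ⟨v, hv⟩
    rw [Fintype.card_fin] at h2
    have h3 := (p' ⟨v, hv⟩).1.2
    have h4 := Nat.mul_le_mul_left n h2
    rw [hb' ⟨v, hv⟩]
    linarith
  rw [hobj p a hpa, hobj p' b hb'] at h1
  have h2 := hacc.cost_le_surrogate p hpn
  simp only [hpp] at h2
  rw [← G.two_mul_cost] at h2 hp'
  have h3 : m * G.cost (Setoid.ker fun v : Fin n => a v) ≤ m * (2800 * G.cost C') := by linarith
  exact_mod_cast Nat.le_of_mul_le_mul_left h3 hm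

end Sketch

/-! ### Total correctness rules for the word RAM -/

namespace StreamRAM

section Semantics

/-- The value of an expression in unbounded arithmetic. -/
def Expr.val (s : State) : Expr → ℕ
  | .lit k => k
  | .reg r => s.reg r
  | .load a => s.mem (a.val s)
  | .bin o e f => o.apply (e.val s) (f.val s)

/-- The evaluation of an expression does not fault. -/
def Expr.Ok (S W : ℕ) (s : State) : Expr → Prop
  | .lit k => k < W
  | .reg _ => True
  | .load a => a.Ok S W s ∧ a.val s < S
  | .bin o e f => e.Ok S W s ∧ f.Ok S W s ∧ o.apply (e.val s) (f.val s) < W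

theorem Expr.eval_eq {S W : ℕ} {s : State} {e : Expr} (h : e.Ok S W s) :
    e.eval S W s = some (e.val s) := by
  induction e with
  | lit k => exact if_pos h
  | reg r => rfl
  | load a ih => simp only [Expr.eval, ih h.1, Option.bind_some, if_pos h.2, Expr.val]
  | bin o e f ihe ihf =>
    simp only [Expr.eval, ihe h.1, ihf h.2.1, Option.bind_some, if_pos h.2.2, Expr.val]

@[simp] theorem State.setReg_reg (s : State) (r x r' : ℕ) :
    (s.setReg r x).reg r' = if r' = r then x else s.reg r' := Function.update_apply ..
@[simp] theorem State.setReg_mem (s : State) (r x : ℕ) : (s.setReg r x).mem = s.mem := rfl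
@[simp] theorem State.setReg_input (s : State) (r x : ℕ) : (s.setReg r x).input = s.input := rfl
@[simp] theorem State.setReg_used (s : State) (r x : ℕ) : (s.setReg r x).used = s.used := rfl
@[simp] theorem State.setMem_mem (s : State) (a x a' : ℕ) :
    (s.setMem a x).mem a' = if a' = a then x else s.mem a' := Function.update_apply ..
@[simp] theorem State.setMem_reg (s : State) (a x : ℕ) : (s.setMem a x).reg = s.reg := rfl
@[simp] theorem State.setMem_input (s : State) (a x : ℕ) : (s.setMem a x).input = s.input := rfl
@[simp] theorem State.setMem_used (s : State) (a x : ℕ) : (s.setMem a x).used = s.used := rfl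

variable {S W : ℕ} {ω : ℕ → Bool}

/-- Total correctness: `c` started in `s` halts without a fault in a state with the property
`Q`. -/
def Run (S W : ℕ) (ω : ℕ → Bool) (c : Cmd) (s : State) (Q : State → Prop) : Prop :=
  ∃ t, Exec S W ω c s t ∧ Q t

variable {c d : Cmd} {s : State} {Q R : State → Prop} {e a : Expr} {r : ℕ}

theorem Run.mono (h : Run S W ω c s R) (hQ : ∀ t, R t → Q t) : Run S W ω c s Q :=
  h.imp fun t ht => ⟨ht.1, hQ t ht.2⟩

theorem run_skip (h : Q s) : Run S W ω .skip s Q := ⟨s, .skip, h⟩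

theorem run_assign (he : e.Ok S W s) (h : Q (s.setReg r (e.val s))) :
    Run S W ω (.assign r e) s Q := ⟨_, .assign (Expr.eval_eq he), h⟩

theorem run_store (ha : a.Ok S W s) (haS : a.val s < S) (he : e.Ok S W s)
    (h : Q (s.setMem (a.val s) (e.val s))) : Run S W ω (.store a e) s Q :=
  ⟨_, .store (Expr.eval_eq ha) haS (Expr.eval_eq he), h⟩

theorem run_coin (h : Q (({ s with used := s.used + 1 } : State).setReg r (ω s.used).toNat)) :
    Run S W ω (.coin r) s Q := ⟨_, .coin, h⟩

theorem run_seq (hc : Run S W ω c s R) (hd : ∀ t, R t → Run S W ω d t Q) :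
    Run S W ω (.seq c d) s Q := by
  obtain ⟨t, ht, hR⟩ := hc
  obtain ⟨w, hw, hQ⟩ := hd t hR
  exact ⟨w, .seq ht hw, hQ⟩

theorem run_ite (he : e.Ok S W s) (hc : e.val s ≠ 0 → Run S W ω c s Q)
    (hd : e.val s = 0 → Run S W ω d s Q) : Run S W ω (.ite e c d) s Q := by
  have hv := Expr.eval_eq he
  by_cases h : e.val s = 0
  · obtain ⟨t, ht, hQ⟩ := hd h
    rw [h] at hv
    exact ⟨t, .ite_false hv ht, hQ⟩
  · obtain ⟨t, ht, hQ⟩ := hc h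
    exact ⟨t, .ite_true hv h ht, hQ⟩

/-- A loop whose `N` passes go through the assertions `I k`, …, `I N`. -/
theorem run_loop (I : ℕ → State → Prop) {N k : ℕ} (hk : k ≤ N)
    (hstep : ∀ k < N, ∀ t, I k t → e.Ok S W t ∧ e.val t ≠ 0 ∧ Run S W ω c t (I (k + 1)))
    (hend : ∀ t, I N t → e.Ok S W t ∧ e.val t = 0 ∧ Q t) (h0 : I k s) :
    Run S W ω (.loop e c) s Q := by
  induction hj : N - k generalizing k s with
  | zero =>
    obtain rfl : k = N := by omega
    obtain ⟨he, hv, hQ⟩ := hend s h0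
    exact ⟨s, .loop_false (hv ▸ Expr.eval_eq he), hQ⟩
  | succ j ih =>
    obtain ⟨he, hv, t, ht, hI⟩ := hstep k (by omega) s h0
    obtain ⟨w, hw, hQ⟩ := ih (by omega) hI (by omega)
    exact ⟨w, .loop_true (Expr.eval_eq he) hv ht hw, hQ⟩

/-- Run `c` for the values `0, 1, …` of register `i` that are below register `b`. -/
def forLoop (i b : ℕ) (c : Cmd) : Cmd :=
  .seq (.assign i (.lit 0)) (.loop (.bin .lt (.reg i) (.reg b))
    (.seq c (.assign i (.bin .add (.reg i) (.lit 1)))))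

/-- The assertion for `k + 1` is required after the counter update that the loop itself appends, so
the body only has to leave the counter intact. -/
theorem run_forLoop (I : ℕ → State → Prop) {i b N : ℕ} (hW : 1 < W) (hN : N < W)
    (hreg : ∀ k, ∀ t, I k t → t.reg i = k ∧ t.reg b = N)
    (hstep : ∀ k < N, ∀ t, I k t →
      Run S W ω c t fun t' => t'.reg i = k ∧ I (k + 1) (t'.setReg i (k + 1)))
    (h0 : I 0 (s.setReg i 0)) : Run S W ω (forLoop i b c) s (I N) := by
  refine run_seq (R := I 0) (run_assign (show 0 < W by omega) h0) fun t ht => ?_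
  refine run_loop I (Nat.zero_le N) (fun k hk t ht => ?_) (fun t ht => ?_) ht
  · obtain ⟨h1, h2⟩ := hreg k t ht
    simp only [Expr.Ok, Expr.val, BinOp.apply, h1, h2, if_pos hk]
    refine ⟨⟨trivial, trivial, hW⟩, one_ne_zero, run_seq (hstep k hk t ht) fun t' ht' => ?_⟩
    refine run_assign ?_ ?_
    · simp only [Expr.Ok, Expr.val, BinOp.apply, ht'.1]
      exact ⟨trivial, hW, by omega⟩
    · simpa only [Expr.val, BinOp.apply, ht'.1] using ht'.2
  · obtain ⟨h1, h2⟩ := hreg N t ht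
    simp only [Expr.Ok, Expr.val, BinOp.apply, h1, h2, lt_irrefl, if_false]
    exact ⟨⟨trivial, trivial, by omega⟩, trivial, ht⟩

/-- `t` differs from `s` at most in the registers `k, k + 1, …`. -/
structure Frame (k : ℕ) (s t : State) : Prop where
  mem : t.mem = s.mem
  input : t.input = s.input
  used : t.used = s.used
  reg : ∀ r < k, t.reg r = s.reg r

theorem Frame.refl (k : ℕ) (s : State) : Frame k s s := ⟨rfl, rfl, rfl, fun _ _ => rfl⟩

theorem Frame.trans {k : ℕ} {s t w : State} (h : Frame k s t) (h' : Frame k t w) : Frame k s w :=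
  ⟨h'.mem.trans h.mem, h'.input.trans h.input, h'.used.trans h.used,
    fun r hr => (h'.reg r hr).trans (h.reg r hr)⟩

theorem Frame.mono {k l : ℕ} {s t : State} (h : Frame l s t) (hkl : k ≤ l) : Frame k s t :=
  ⟨h.mem, h.input, h.used, fun r hr => h.reg r (hr.trans_le hkl)⟩

theorem Frame.setReg {k : ℕ} {s t : State} (h : Frame k s t) {r : ℕ} (hr : k ≤ r) (x : ℕ) :
    Frame k s (t.setReg r x) :=
  ⟨h.mem, h.input, h.used, fun r' hr' => by
    rw [State.setReg_reg, if_neg (by omega)]; exact h.reg r' hr'⟩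

/-- A loop that adds up the values `f 0`, …, `f (N - 1)` in register `r`. -/
theorem run_sumLoop {k i b r N : ℕ} (f : ℕ → ℕ) (hW : 1 < W) (hN : N < W) (hi : k ≤ i)
    (hir : r ≠ i) (hb : b < k) (hbN : s.reg b = N)
    (hstep : ∀ j < N, ∀ t, Frame k s t → t.reg i = j →
      t.reg r = s.reg r + ∑ l ∈ Finset.range j, f l →
      Run S W ω c t fun t' => Frame k t t' ∧ t'.reg i = j ∧ t'.reg r = t.reg r + f j) :
    Run S W ω (forLoop i b c) s fun t => Frame k s t ∧
      t.reg r = s.reg r + ∑ l ∈ Finset.range N, f l := by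
  refine (run_forLoop (fun j t => Frame k s t ∧ t.reg i = j ∧
    t.reg r = s.reg r + ∑ l ∈ Finset.range j, f l) (N := N) hW hN (fun j t ht => ?_)
    (fun j hj t ht => ?_) ?_).mono fun t ht => ⟨ht.1, ht.2.2⟩
  · exact ⟨ht.2.1, (ht.1.reg b hb).trans hbN⟩
  · refine (hstep j hj t ht.1 ht.2.1 ht.2.2).mono fun t' ht' => ⟨ht'.2.1, ?_, ?_, ?_⟩
    · exact (ht.1.trans ht'.1).setReg hi _
    · simp
    · rw [State.setReg_reg, if_neg hir, ht'.2.2, ht.2.2, Finset.sum_range_succ, add_assoc]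
  · exact ⟨(Frame.refl k s).setReg hi _, by simp, by simp [hir]⟩

end Semantics

end StreamRAM

/-! ### Evaluating the objective within the memory and the word size -/

theorem maskSum_le {n : ℕ} {x : ℕ → ℕ} (hx : ∀ w, x w ≤ 2) (A : ℕ → Prop) :
    maskSum n x A ≤ 2 * n := by
  classical
  have : ∀ w ∈ Finset.range n, (if A w then x w else 1) ≤ 2 := fun w _ => by
    split_ifs
    · exact hx w
    · norm_num
  simpa [maskSum, mul_comm] using Finset.sum_le_card_nsmul _ _ _ this

/-- All partial sums are bounded, not only the full one: every intermediate value of the accumulator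
must fit into a word. -/
theorem sum_dist_sq_le {m K : ℕ} {f g : ℕ → ℕ} (hf : ∀ j, f j ≤ K) (hg : ∀ j, g j ≤ K) (j : ℕ)
    (hj : j ≤ m) : ∑ i ∈ Finset.range j, Nat.dist (f i) (g i) ^ 2 ≤ m * K ^ 2 := by
  have : ∀ i ∈ Finset.range j, Nat.dist (f i) (g i) ^ 2 ≤ K ^ 2 := fun i _ => by
    refine Nat.pow_le_pow_left ?_ 2
    have := hf i
    have := hg i
    unfold Nat.dist
    omega
  refine (Finset.sum_le_card_nsmul _ _ _ this).trans ?_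
  rw [Finset.card_range, smul_eq_mul]
  exact Nat.mul_le_mul_right _ hj

theorem mul_add_lt_mul {j J w n : ℕ} (hj : j < J) (hw : w < n) : j * n + w < J * n := by
  have := Nat.mul_le_mul_right n (Nat.succ_le_of_lt hj)
  rw [Nat.succ_mul] at this
  omega

namespace StreamRAM

/-- The absolute difference of two values. -/
def Expr.dist (e f : Expr) : Expr := .bin .add (.bin .sub e f) (.bin .sub f e)

/-- The cell of the random sign in row `j` and column `w`. -/
def signAddr (j w : Expr) : Expr := .bin .add (.reg 0) (.bin .add (.bin .mul j (.reg 0)) w)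

/-- The cell of the sketch in row `j` and column `u`. -/
def sketchAddr (j u : ℕ) : Expr :=
  .bin .add (.reg 2) (.bin .add (.bin .mul (.reg j) (.reg 0)) (.reg u))

/-- Register `14` := the estimated distance of the vertices in the registers `x` and `y`. -/
def distCmd (x y : ℕ) : Cmd :=
  .seq (.assign 14 (.lit 0)) (forLoop 12 1
    (.seq (.assign 13 (.dist (.load (sketchAddr 12 x)) (.load (sketchAddr 12 y))))
      (.assign 14 (.bin .add (.reg 14) (.bin .mul (.reg 13) (.reg 13))))))

/-- Adds to register `8` the estimated distance of the neighborhood of the vertex in register `6`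
and its ball with the threshold in register `7`. -/
def ballCmd : Cmd :=
  forLoop 9 1
    (.seq (.assign 10 (.lit 0))
    (.seq (forLoop 11 0
      (.seq (distCmd 6 11)
      (.ite (.bin .lt (.bin .mul (.lit 16) (.reg 14)) (.reg 7))
        (.assign 10 (.bin .add (.reg 10) (.lit 1)))
        (.assign 10 (.bin .add (.reg 10)
          (.load (signAddr (.bin .add (.reg 1) (.reg 9)) (.reg 11))))))))
    (.seq (.assign 12 (.bin .add (.reg 1) (.reg 9)))
    (.seq (.assign 13 (.dist (.reg 10) (.load (sketchAddr 12 6))))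
      (.assign 8 (.bin .add (.reg 8) (.bin .mul (.reg 13) (.reg 13))))))))

/-- Adds to register `8` the mismatch of the cluster of the vertex in register `5` and the ball
around the vertex in register `6` with the threshold in register `7`. -/
def mismatchCmd : Cmd :=
  forLoop 11 0
    (.seq (distCmd 6 11)
    (.ite (.bin .eq (.bin .lt (.bin .mul (.lit 16) (.reg 14)) (.reg 7))
        (.bin .eq (.load (.reg 11)) (.load (.reg 5))))
      .skip
      (.assign 8 (.bin .add (.reg 8) (.reg 1)))))

/-- Register `4` := the objective of the clustering in the cells `0, …, n - 1`. -/
def objectiveCmd : Cmd :=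
  .seq (.assign 4 (.lit 0)) (forLoop 5 0
    (.seq (.assign 6 (.bin .mod (.load (.reg 5)) (.reg 0)))
    (.seq (.assign 7 (.bin .mul (.reg 1) (.bin .div (.load (.reg 5)) (.reg 0))))
    (.seq (distCmd 5 6)
    (.seq (.assign 8 (.reg 14))
    (.seq ballCmd
    (.seq mismatchCmd
      (.assign 4 (.bin .add (.reg 4) (.reg 8))))))))))

/-- Memory and words are large enough. -/
structure Capacity (S W n m : ℕ) : Prop where
  two_le : 2 ≤ n
  pos : 0 < m
  mem : n + 4 * (m * n) ≤ S
  word : 64 * (m * n ^ 3) < W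

namespace Capacity

variable {S W n m : ℕ} (h : Capacity S W n m)
include h

theorem mul_pow_le {i j : ℕ} (hi : i ≤ 1) (hj : j ≤ 3) : m ^ i * n ^ j ≤ m * n ^ 3 := by
  have h2 := h.two_le
  have h3 := h.pos
  calc m ^ i * n ^ j ≤ m ^ 1 * n ^ 3 :=
        Nat.mul_le_mul (Nat.pow_le_pow_right h3 hi) (Nat.pow_le_pow_right (by omega) hj)
    _ = m * n ^ 3 := by rw [pow_one]

/-- With these comparisons the overflow checks become linear in the monomials. The factor `64` in
`Capacity.word` covers the threshold test, which multiplies a distance of at most `4 * (m * n ^ 2)`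
by `16`. -/
theorem bounds : 8 ≤ m * n ^ 3 ∧ n ≤ m * n ^ 3 ∧ m ≤ m * n ^ 3 ∧ m * n ≤ m * n ^ 3 ∧
    m * n ^ 2 ≤ m * n ^ 3 ∧ n ^ 2 ≤ m * n ^ 3 := by
  refine ⟨?_, by simpa using h.mul_pow_le (i := 0) (j := 1) (by omega) (by omega),
    by simpa using h.mul_pow_le (i := 1) (j := 0) (by omega) (by omega),
    by simpa using h.mul_pow_le (i := 1) (j := 1) (by omega) (by omega),
    by simpa using h.mul_pow_le (i := 1) (j := 2) (by omega) (by omega),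
    by simpa using h.mul_pow_le (i := 0) (j := 2) (by omega) (by omega)⟩
  have h1 := Nat.pow_le_pow_left h.two_le 3
  have h2 := Nat.mul_le_mul_right (n ^ 3) h.pos
  omega

end Capacity

/-- The registers and the memory hold the parameters, the random signs `X`, the sketches `Y` and
the cluster names `a`. -/
structure Layout (n m : ℕ) (X Y : ℕ → ℕ → ℕ) (a : ℕ → ℕ) (s : State) : Prop where
  reg0 : s.reg 0 = n
  reg1 : s.reg 1 = m
  reg2 : s.reg 2 = n + 2 * m * n
  sign : ∀ j < 2 * m, ∀ w < n, s.mem (n + (j * n + w)) = X j w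
  sketch : ∀ j < 2 * m, ∀ u < n, s.mem (n + 2 * m * n + (j * n + u)) = Y j u
  name : ∀ v < n, s.mem v = a v

theorem Layout.frame {n m : ℕ} {X Y : ℕ → ℕ → ℕ} {a : ℕ → ℕ} {s t : State}
    (h : Layout n m X Y a s) {k : ℕ} (hf : Frame k s t) (hk : 3 ≤ k) : Layout n m X Y a t where
  reg0 := (hf.reg 0 (by omega)).trans h.reg0
  reg1 := (hf.reg 1 (by omega)).trans h.reg1
  reg2 := (hf.reg 2 (by omega)).trans h.reg2
  sign := by rw [hf.mem]; exact h.sign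
  sketch := by rw [hf.mem]; exact h.sketch
  name := by rw [hf.mem]; exact h.name

section

variable {S W : ℕ} {ω : ℕ → Bool} {n m : ℕ} {X Y : ℕ → ℕ → ℕ} {a : ℕ → ℕ} {s : State}

theorem Layout.sketchAddr_ok (hc : Capacity S W n m) (h : Layout n m X Y a s) {j u : ℕ}
    (hj : s.reg j < 2 * m) (hu : s.reg u < n) :
    (sketchAddr j u).Ok S W s ∧ (sketchAddr j u).val s < S ∧
      s.mem ((sketchAddr j u).val s) = Y (s.reg j) (s.reg u) := by
  have h1 := mul_add_lt_mul hj hu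
  have h2 := hc.mem
  have h3 := hc.word
  obtain ⟨-, h4, -, h5, -, -⟩ := hc.bounds
  have h6 : 2 * m * n = 2 * (m * n) := by ring
  simp only [sketchAddr, Expr.Ok, Expr.val, BinOp.apply, h.reg0, h.reg2, true_and]
  refine ⟨⟨⟨?_, ?_⟩, ?_⟩, ?_, h.sketch _ hj _ hu⟩ <;> omega

/-- Inner routines work in higher registers than their callers, so a `Frame` for the registers from
`12` on preserves all surrounding loops. -/
theorem run_distCmd (hc : Capacity S W n m) (hY : ∀ j u, Y j u ≤ 2 * n)
    (h : Layout n m X Y a s) {x y : ℕ} (hx : x < 12) (hy : y < 12) (hxn : s.reg x < n)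
    (hyn : s.reg y < n) :
    Run S W ω (distCmd x y) s fun t =>
      Frame 12 s t ∧ t.reg 14 = sketchDist Y m (s.reg x) (s.reg y) := by
  have hw := hc.word
  obtain ⟨b1, b2, b3, b4, b5, b6⟩ := hc.bounds
  refine run_seq (R := fun t => t = s.setReg 14 0) (run_assign (show 0 < W by omega) rfl) ?_
  rintro _ rfl
  have hf0 : Frame 12 s (s.setReg 14 0) := (Frame.refl 12 s).setReg (by omega) 0
  refine (run_sumLoop (k := 12) (N := m) (r := 14)
    (fun j => Nat.dist (Y j (s.reg x)) (Y j (s.reg y)) ^ 2) (by omega) (by omega) (by omega)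
    (by omega) (by omega) (h.frame hf0 (by omega)).reg1 ?_).mono fun t ht =>
      ⟨hf0.trans ht.1, by rw [ht.2]; simp [sketchDist]⟩
  intro j hj t hft htj htr
  have hft' := hf0.trans hft
  have hl := h.frame hft' (by omega)
  have ex := hft'.reg x hx
  have ey := hft'.reg y hy
  obtain ⟨o1, o2, o3⟩ := hl.sketchAddr_ok hc (j := 12) (u := x) (by omega) (by omega)
  obtain ⟨p1, p2, p3⟩ := hl.sketchAddr_ok hc (j := 12) (u := y) (by omega) (by omega)
  rw [htj, ex] at o3
  rw [htj, ey] at p3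
  have hsum := sum_dist_sq_le (m := m) (fun j => hY j (s.reg x)) (fun j => hY j (s.reg y))
    (j + 1) hj
  rw [Finset.sum_range_succ] at hsum
  have e1 : m * (2 * n) ^ 2 = 4 * (m * n ^ 2) := by ring
  have y1 := hY j (s.reg x)
  have y2 := hY j (s.reg y)
  rw [State.setReg_reg, if_pos rfl, zero_add] at htr
  refine run_seq (R := fun t' => t' = t.setReg 13 (Nat.dist (Y j (s.reg x)) (Y j (s.reg y))))
    (run_assign ?_ ?_) ?_
  · simp only [Expr.dist, Expr.Ok, Expr.val, BinOp.apply, o1, o2, o3, p1, p2, p3, true_and]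
    omega
  · simp only [Expr.dist, Expr.val, BinOp.apply, o3, p3]
    rfl
  · rintro _ rfl
    refine run_assign ?_ ?_
    · simp only [Expr.Ok, Expr.val, BinOp.apply, true_and, State.setReg_reg, if_pos, htr, ← pow_two]
      simp
      omega
    · refine ⟨((Frame.refl 12 t).setReg (by omega) _).setReg (by omega) _, ?_, ?_⟩
      · simp [htj]
      · simp [Expr.val, BinOp.apply, pow_two]

end

end StreamRAM

namespace StreamRAM

section

variable {S W : ℕ} {ω : ℕ → Bool} {n m : ℕ} {X Y : ℕ → ℕ → ℕ} {a : ℕ → ℕ} {s : State}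

theorem sketchDist_le (hY : ∀ j u, Y j u ≤ 2 * n) (u v : ℕ) :
    sketchDist Y m u v ≤ 4 * (m * n ^ 2) := by
  have := sum_dist_sq_le (m := m) (fun j => hY j u) (fun j => hY j v) m le_rfl
  unfold sketchDist
  linarith

theorem Layout.signAddr_ok (hc : Capacity S W n m) (h : Layout n m X Y a s) {j w : Expr}
    (hj : j.Ok S W s) (hw : w.Ok S W s) (hjm : j.val s < 2 * m) (hwn : w.val s < n) :
    (signAddr j w).Ok S W s ∧ (signAddr j w).val s < S ∧
      s.mem ((signAddr j w).val s) = X (j.val s) (w.val s) := by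
  have h1 := mul_add_lt_mul hjm hwn
  have h2 := hc.mem
  have h3 := hc.word
  obtain ⟨-, h4, -, h5, -, -⟩ := hc.bounds
  have h6 : 2 * m * n = 2 * (m * n) := by ring
  simp only [signAddr, Expr.Ok, Expr.val, BinOp.apply, h.reg0, true_and, hj, hw]
  refine ⟨⟨⟨?_, ?_⟩, ?_⟩, ?_, h.sign _ hjm _ hwn⟩ <;> omega

/-- Membership in the ball is recomputed from the first `m` rows for every vertex and every row of
the second block. No ball is ever stored. -/
theorem run_ballCmd (hc : Capacity S W n m) (hX : ∀ j w, X j w ≤ 2) (hY : ∀ j u, Y j u ≤ 2 * n)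
    (h : Layout n m X Y a s) {u σ : ℕ} (hu : s.reg 6 = u) (hun : u < n) (hσ : s.reg 7 = m * σ)
    (h8 : s.reg 8 ≤ 4 * (m * n ^ 2)) :
    Run S W ω ballCmd s fun t => Frame 8 s t ∧ t.reg 8 = s.reg 8 + ballDist X Y n m u σ := by
  classical
  have hw := hc.word
  obtain ⟨b1, b2, b3, b4, b5, b6⟩ := hc.bounds
  refine run_sumLoop (k := 8) (N := m) (r := 8) _ (by omega) (by omega) (by omega)
    (by omega) (by omega) h.reg1 ?_
  intro j hj t hft htj htr
  set g : ℕ → ℕ := fun w => if ¬ 16 * sketchDist Y m u w < m * σ then X (m + j) w else 1 with hg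
  have hg2 : ∀ k, ∑ w ∈ Finset.range k, g w ≤ 2 * k := fun k => by
    have h2 : ∀ w ∈ Finset.range k, g w ≤ 2 := fun w _ => by
      simp only [hg]
      split_ifs
      · norm_num
      · exact hX _ _
    simpa [mul_comm] using Finset.sum_le_card_nsmul _ _ _ h2
  have hgn : maskSum n (X (m + j)) (fun w => ¬ 16 * sketchDist Y m u w < m * σ) =
      ∑ w ∈ Finset.range n, g w :=
    Finset.sum_congr rfl fun w _ => by simp only [hg]; congr
  have hl := h.frame hft (by omega)
  refine run_seq (R := fun t' => t' = t.setReg 10 0) (run_assign (show 0 < W by omega) rfl) ?_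
  rintro _ rfl
  have hf0 : Frame 10 t (t.setReg 10 0) := (Frame.refl 10 t).setReg (by omega) 0
  have hl0 := hl.frame hf0 (by omega)
  refine run_seq (run_sumLoop (k := 10) (N := n) (r := 10) g (by omega) (by omega) (by omega)
    (by omega) (by omega) hl0.reg0 ?_) ?_
  · intro w hwn t₁ hf₁ hw₁ hr₁
    have hl₁ := hl0.frame hf₁ (by omega)
    have hfs := hft.trans ((hf0.trans hf₁).mono (by omega : 8 ≤ 10))
    have hu₁ : t₁.reg 6 = u := (hfs.reg 6 (by omega)).trans hu
    have hj₁ : t₁.reg 9 = j := ((hf0.trans hf₁).reg 9 (by omega)).trans htj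
    have hσ₁ : t₁.reg 7 = m * σ := (hfs.reg 7 (by omega)).trans hσ
    refine run_seq (run_distCmd hc hY hl₁ (by omega) (by omega) (by omega) (by omega)) ?_
    rintro t₂ ⟨hf₂, hr₂⟩
    have hl₂ := hl₁.frame hf₂ (by omega)
    have hj₂ := (hf₂.reg 9 (by omega)).trans hj₁
    have hw₂ := (hf₂.reg 11 (by omega)).trans hw₁
    have hz₂ := hf₂.reg 10 (by omega)
    have hσ₂ := (hf₂.reg 7 (by omega)).trans hσ₁
    rw [hu₁, hw₁] at hr₂
    have hd := sketchDist_le (m := m) hY u w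
    have hgw := hg2 (w + 1)
    rw [Finset.sum_range_succ] at hgw
    rw [State.setReg_reg, if_pos rfl, zero_add] at hr₁
    have hfin : ∀ x, x = t₁.reg 10 + g w → Frame 10 t₁ (t₂.setReg 10 x) ∧
        (t₂.setReg 10 x).reg 11 = w ∧ (t₂.setReg 10 x).reg 10 = t₁.reg 10 + g w := by
      rintro _ rfl
      exact ⟨(hf₂.mono (by omega)).setReg (by omega) _, by simp [hw₂], by simp⟩
    refine run_ite ?_ (fun hv => ?_) (fun hv => ?_)
    · simp only [Expr.Ok, Expr.val, BinOp.apply, hr₂, hσ₂, true_and]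
      split_ifs <;> omega
    · simp only [Expr.val, BinOp.apply, hr₂, hσ₂] at hv
      have hlt : 16 * sketchDist Y m u w < m * σ := by
        by_contra hcon
        simp [hcon] at hv
      have hg1 : g w = 1 := by simp only [hg, hlt, not_true_eq_false, if_false]
      refine run_assign ?_ (hfin _ ?_)
      · simp only [Expr.Ok, Expr.val, BinOp.apply, hz₂, true_and]
        omega
      · simp only [Expr.val, BinOp.apply, hz₂, hg1]
    · simp only [Expr.val, BinOp.apply, hr₂, hσ₂] at hv
      have hlt : ¬ 16 * sketchDist Y m u w < m * σ := by
        intro hcon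
        simp [hcon] at hv
      have hg1 : g w = X (m + j) w := by simp only [hg, hlt, not_false_eq_true, if_true]
      obtain ⟨o1, o2, o3⟩ := hl₂.signAddr_ok hc (j := .bin .add (.reg 1) (.reg 9)) (w := .reg 11)
        (by simp only [Expr.Ok, Expr.val, BinOp.apply, true_and, hl₂.reg1]; omega) trivial
        (by simp only [Expr.val, BinOp.apply, hl₂.reg1]; omega)
        (by simp only [Expr.val]; omega)
      have o4 : X (t₂.reg 1 + t₂.reg 9) (t₂.reg 11) = g w := by rw [hl₂.reg1, hj₂, hw₂, hg1]
      simp only [Expr.val, BinOp.apply, o4] at o3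
      refine run_assign ?_ (hfin _ ?_)
      · simp only [Expr.Ok, Expr.val, BinOp.apply, hz₂, true_and, o1, o2, o3]
        omega
      · simp only [Expr.val, BinOp.apply, hz₂, o3]
  · rintro t₁ ⟨hf₁, hr₁⟩
    rw [State.setReg_reg, if_pos rfl, zero_add, ← hgn] at hr₁
    have hft₁ := hf0.trans hf₁
    have hl₁ := hl.frame hft₁ (by omega)
    have hfs := hft.trans (hft₁.mono (by omega : 8 ≤ 10))
    have hu₁ : t₁.reg 6 = u := (hfs.reg 6 (by omega)).trans hu
    have hj₁ : t₁.reg 9 = j := (hft₁.reg 9 (by omega)).trans htj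
    have hr8 : t₁.reg 8 = t.reg 8 := hft₁.reg 8 (by omega)
    have hz := maskSum_le (n := n) (hX (m + j)) fun w => ¬ 16 * sketchDist Y m u w < m * σ
    have hsum := sum_dist_sq_le (m := m)
      (fun j => maskSum_le (n := n) (hX (m + j)) fun w => ¬ 16 * sketchDist Y m u w < m * σ)
      (fun j => hY (m + j) u) (j + 1) hj
    rw [Finset.sum_range_succ] at hsum
    have e1 : m * (2 * n) ^ 2 = 4 * (m * n ^ 2) := by ring
    rw [e1] at hsum
    set z := maskSum n (X (m + j)) fun w => ¬ 16 * sketchDist Y m u w < m * σ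
    refine run_seq (R := fun t' => t' = t₁.setReg 12 (m + j)) (run_assign ?_ ?_) ?_
    · simp only [Expr.Ok, Expr.val, BinOp.apply, true_and, hl₁.reg1, hj₁]
      omega
    · simp only [Expr.val, BinOp.apply, hl₁.reg1, hj₁]
    rintro _ rfl
    have hf₂ : Frame 10 t₁ (t₁.setReg 12 (m + j)) := (Frame.refl 10 t₁).setReg (by omega) _
    have hl₂ := hl₁.frame hf₂ (by omega)
    obtain ⟨o1, o2, o3⟩ := hl₂.sketchAddr_ok hc (j := 12) (u := 6) (by simp; omega)
      (by simp; omega)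
    have o4 : Y ((t₁.setReg 12 (m + j)).reg 12) ((t₁.setReg 12 (m + j)).reg 6) = Y (m + j) u := by
      simp [hu₁]
    rw [o4] at o3
    have hy := hY (m + j) u
    refine run_seq (R := fun t' => t' = (t₁.setReg 12 (m + j)).setReg 13 (Nat.dist z (Y (m + j) u)))
      (run_assign ?_ ?_) ?_
    · simp only [Expr.dist, Expr.Ok, Expr.val, BinOp.apply, o1, o2, o3, true_and,
        State.setReg_reg, hr₁]
      simp
      omega
    · simp only [Expr.dist, Expr.val, BinOp.apply, o3]
      simp [hr₁, Nat.dist]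
    rintro _ rfl
    refine run_assign ?_ ⟨?_, ?_, ?_⟩
    · simp only [Expr.Ok, Expr.val, BinOp.apply, true_and, State.setReg_reg, ← pow_two]
      simp [hr8]
      omega
    · exact (((hft₁.trans hf₂).mono (by omega)).setReg (by omega) _).setReg le_rfl _
    · simp [hj₁]
    · simp [Expr.val, BinOp.apply, pow_two, hr8, z]

end

end StreamRAM

namespace StreamRAM

section

variable {S W : ℕ} {ω : ℕ → Bool} {n m : ℕ} {X Y : ℕ → ℕ → ℕ} {a : ℕ → ℕ} {s : State}

theorem ballDist_le (hX : ∀ j w, X j w ≤ 2) (hY : ∀ j u, Y j u ≤ 2 * n) (u σ : ℕ) :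
    ballDist X Y n m u σ ≤ 4 * (m * n ^ 2) := by
  have := sum_dist_sq_le (m := m)
    (fun j => maskSum_le (n := n) (hX (m + j)) fun w => ¬ 16 * sketchDist Y m u w < m * σ)
    (fun j => hY (m + j) u) m le_rfl
  unfold ballDist
  linarith

theorem mismatch_le (v : ℕ) : mismatch Y n m a v ≤ m * n := by
  classical
  have h2 : ∀ w ∈ Finset.range n, (if (16 * sketchDist Y m (a v % n) w < m * (a v / n) ↔
      a w = a v) then 0 else m) ≤ m := fun w _ => by
    split_ifs <;> omega
  refine le_trans (le_of_eq ?_) ((Finset.sum_le_card_nsmul _ _ _ h2).trans ?_)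
  · unfold mismatch
    congr
  · rw [Finset.card_range, smul_eq_mul, mul_comm]

theorem run_mismatchCmd (hc : Capacity S W n m) (hY : ∀ j u, Y j u ≤ 2 * n)
    (h : Layout n m X Y a s) {v : ℕ} (hv : s.reg 5 = v) (hvn : v < n)
    (hu : s.reg 6 = a v % n) (hσ : s.reg 7 = m * (a v / n)) (h8 : s.reg 8 ≤ 8 * (m * n ^ 2)) :
    Run S W ω mismatchCmd s fun t => Frame 8 s t ∧ t.reg 8 = s.reg 8 + mismatch Y n m a v := by
  classical
  have hw := hc.word
  have hcm := hc.mem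
  obtain ⟨b1, b2, b3, b4, b5, b6⟩ := hc.bounds
  set g : ℕ → ℕ := fun w =>
    if (16 * sketchDist Y m (a v % n) w < m * (a v / n) ↔ a w = a v) then 0 else m with hg
  have hgm : mismatch Y n m a v = ∑ w ∈ Finset.range n, g w := by
    unfold mismatch
    congr
  have hgk : ∀ k ≤ n, ∑ w ∈ Finset.range k, g w ≤ m * n := fun k hk => by
    have hle := mismatch_le (Y := Y) (n := n) (m := m) (a := a) v
    rw [hgm] at hle
    exact (Finset.sum_le_sum_of_subset (Finset.range_subset_range.2 hk)).trans hle
  rw [hgm]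
  refine run_sumLoop (k := 8) (N := n) (r := 8) g (by omega) (by omega) (by omega)
    (by omega) (by omega) h.reg0 ?_
  intro w hwn t hft hwt hr
  have hl := h.frame hft (by omega)
  have hu₁ := (hft.reg 6 (by omega)).trans hu
  have hun : a v % n < n := Nat.mod_lt _ (by omega)
  refine run_seq (run_distCmd hc hY hl (by omega) (by omega) (by omega) (by omega)) ?_
  rintro t₂ ⟨hf₂, hr₂⟩
  have hft₂ := hft.trans (hf₂.mono (by omega))
  have hl₂ := h.frame hft₂ (by omega)
  have hw₂ := (hf₂.reg 11 (by omega)).trans hwt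
  have hz₂ := hf₂.reg 8 (by omega)
  have hσ₂ := (hft₂.reg 7 (by omega)).trans hσ
  have hv₂ := (hft₂.reg 5 (by omega)).trans hv
  rw [hu₁, hwt] at hr₂
  have hd := sketchDist_le (m := m) hY (a v % n) w
  have hgw := hgk (w + 1) hwn
  rw [Finset.sum_range_succ] at hgw
  have hnw := hl₂.name w hwn
  have hnv := hl₂.name v hvn
  refine run_ite ?_ (fun hval => ?_) (fun hval => ?_)
  · simp only [Expr.Ok, Expr.val, BinOp.apply, hr₂, hσ₂, hw₂, hv₂, true_and]
    refine ⟨⟨⟨?_, ?_⟩, ?_⟩, ⟨?_, ?_, ?_⟩, ?_⟩ <;> (try split_ifs) <;> omega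
  · simp only [Expr.val, BinOp.apply, hr₂, hσ₂, hw₂, hv₂, hnw, hnv] at hval
    have hg0 : g w = 0 := by
      simp only [hg]
      by_cases h1 : 16 * sketchDist Y m (a v % n) w < m * (a v / n) <;>
        by_cases h2 : a w = a v <;> simp [h1, h2] at hval ⊢
    exact run_skip ⟨hf₂.mono (by omega), hw₂, by rw [hz₂, hg0, add_zero]⟩
  · simp only [Expr.val, BinOp.apply, hr₂, hσ₂, hw₂, hv₂, hnw, hnv] at hval
    have hg0 : g w = m := by
      simp only [hg]
      by_cases h1 : 16 * sketchDist Y m (a v % n) w < m * (a v / n) <;>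
        by_cases h2 : a w = a v <;> simp [h1, h2] at hval ⊢
    refine run_assign ?_ ⟨(hf₂.mono (by omega)).setReg le_rfl _, ?_, ?_⟩
    · simp only [Expr.Ok, Expr.val, BinOp.apply, hz₂, hl₂.reg1, true_and]
      omega
    · rw [State.setReg_reg, if_neg (by omega), hw₂]
    · simp only [Expr.val, BinOp.apply, State.setReg_reg, if_pos, hz₂, hl₂.reg1, hg0]

theorem objective_term_le (hX : ∀ j w, X j w ≤ 2) (hY : ∀ j u, Y j u ≤ 2 * n)
    (v : ℕ) : sketchDist Y m v (a v % n) + ballDist X Y n m (a v % n) (a v / n) +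
      mismatch Y n m a v ≤ 9 * (m * n ^ 2) := by
  have h1 := sketchDist_le (m := m) hY v (a v % n)
  have h2 := ballDist_le (m := m) hX hY (a v % n) (a v / n)
  have h3 := mismatch_le (Y := Y) (n := n) (m := m) (a := a) v
  have h4 : m * n ≤ m * n ^ 2 := Nat.mul_le_mul_left m (Nat.le_self_pow two_ne_zero n)
  omega

theorem objective_partial_le (hX : ∀ j w, X j w ≤ 2) (hY : ∀ j u, Y j u ≤ 2 * n)
    {k : ℕ} (hk : k ≤ n) : ∑ v ∈ Finset.range k, (sketchDist Y m v (a v % n) +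
      ballDist X Y n m (a v % n) (a v / n) + mismatch Y n m a v) ≤ 9 * (m * n ^ 3) := by
  refine (Finset.sum_le_card_nsmul _ _ _ fun v _ => objective_term_le hX hY v).trans ?_
  rw [Finset.card_range, smul_eq_mul]
  calc k * (9 * (m * n ^ 2)) ≤ n * (9 * (m * n ^ 2)) := Nat.mul_le_mul_right _ hk
    _ = 9 * (m * n ^ 3) := by ring

theorem run_objectiveCmd (hc : Capacity S W n m) (hX : ∀ j w, X j w ≤ 2)
    (hY : ∀ j u, Y j u ≤ 2 * n) (ha : ∀ v < n, a v < n * (n + 1)) (h : Layout n m X Y a s) :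
    Run S W ω objectiveCmd s fun t => Frame 4 s t ∧ t.reg 4 = objective X Y n m a := by
  have hw := hc.word
  have hn := hc.two_le
  have hcm := hc.mem
  obtain ⟨b1, b2, b3, b4, b5, b6⟩ := hc.bounds
  refine run_seq (R := fun t => t = s.setReg 4 0) (run_assign (show 0 < W by omega) rfl) ?_
  rintro _ rfl
  have hf0 : Frame 4 s (s.setReg 4 0) := (Frame.refl 4 s).setReg le_rfl 0
  have hl0 := h.frame hf0 (by omega)
  refine (run_sumLoop (k := 4) (N := n) (r := 4) (fun v => sketchDist Y m v (a v % n) +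
    ballDist X Y n m (a v % n) (a v / n) + mismatch Y n m a v) (by omega) (by omega) (by omega)
    (by omega) (by omega) hl0.reg0 ?_).mono fun t ht =>
      ⟨hf0.trans ht.1, by rw [ht.2]; simp [objective]⟩
  intro v hv t hft htv htr
  have hl := hl0.frame hft (by omega)
  rw [State.setReg_reg, if_pos rfl, zero_add] at htr
  have hav := ha v hv
  have hld : t.mem v = a v := hl.name v hv
  have hmod := Nat.mod_lt (a v) (by omega : 0 < n)
  have hdiv : a v / n ≤ n := Nat.lt_succ_iff.1 (Nat.div_lt_of_lt_mul hav)
  have hmd := Nat.mul_le_mul_left m hdiv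
  have hS : v < S := by omega
  have hW' : t.mem v < W ∧ a v % n < W := by constructor <;> nlinarith
  refine run_seq (R := fun t' => t' = t.setReg 6 (a v % n)) (run_assign ?_ ?_) ?_
  · simp only [Expr.Ok, Expr.val, BinOp.apply, true_and, htv, hl.reg0, hS, hld]
    omega
  · simp only [Expr.val, BinOp.apply, htv, hl.reg0, hld]
  rintro _ rfl
  refine run_seq (R := fun t' => t' = (t.setReg 6 (a v % n)).setReg 7 (m * (a v / n)))
    (run_assign ?_ ?_) ?_
  · simp only [Expr.Ok, Expr.val, BinOp.apply, true_and, State.setReg_reg, State.setReg_mem]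
    simp [htv, hl.reg0, hl.reg1, hS, hld]
    omega
  · simp [Expr.val, BinOp.apply, htv, hl.reg0, hl.reg1, hld]
  rintro _ rfl
  have hf1 : Frame 6 t ((t.setReg 6 (a v % n)).setReg 7 (m * (a v / n))) :=
    ((Frame.refl 6 t).setReg le_rfl _).setReg (by omega) _
  generalize ht1 : (t.setReg 6 (a v % n)).setReg 7 (m * (a v / n)) = t₁ at hf1
  have r5 : t₁.reg 5 = v := (hf1.reg 5 (by omega)).trans htv
  have r6 : t₁.reg 6 = a v % n := by simp [← ht1]
  have r7 : t₁.reg 7 = m * (a v / n) := by simp [← ht1]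
  have hl1 := hl.frame hf1 (by omega)
  clear ht1
  refine run_seq (run_distCmd hc hY hl1 (by omega) (by omega) (by omega) (by omega)) ?_
  rintro t₂ ⟨hf2, hr2⟩
  rw [r5, r6] at hr2
  refine run_seq (R := fun t' => t' = t₂.setReg 8 (t₂.reg 14)) (run_assign trivial rfl) ?_
  rintro _ rfl
  have hf3 : Frame 8 t₁ (t₂.setReg 8 (t₂.reg 14)) := (hf2.mono (by omega)).setReg le_rfl _
  have r8 : (t₂.setReg 8 (t₂.reg 14)).reg 8 = sketchDist Y m v (a v % n) := by simp [hr2]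
  generalize t₂.setReg 8 (t₂.reg 14) = t₃ at hf3 r8
  have hl3 := hl1.frame hf3 (by omega)
  have hd := sketchDist_le (m := m) hY v (a v % n)
  refine run_seq (run_ballCmd hc hX hY hl3 ((hf3.reg 6 (by omega)).trans r6) hmod
    ((hf3.reg 7 (by omega)).trans r7) (by omega)) ?_
  rintro t₄ ⟨hf4, hr4⟩
  have hf4' := hf3.trans hf4
  have hl4 := hl1.frame hf4' (by omega)
  have hb := ballDist_le (m := m) hX hY (a v % n) (a v / n)
  refine run_seq (run_mismatchCmd hc hY hl4 ((hf4'.reg 5 (by omega)).trans r5) hv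
    ((hf4'.reg 6 (by omega)).trans r6) ((hf4'.reg 7 (by omega)).trans r7) (by omega)) ?_
  rintro t₅ ⟨hf5, hr5⟩
  have hf5' : Frame 6 t t₅ := hf1.trans ((hf4'.mono (by omega)).trans (hf5.mono (by omega)))
  have hp := objective_partial_le (m := m) (a := a) hX hY (Nat.succ_le_of_lt hv)
  rw [Finset.sum_range_succ] at hp
  have h4 := hf5'.reg 4 (by omega)
  have e : t₅.reg 8 = sketchDist Y m v (a v % n) + ballDist X Y n m (a v % n) (a v / n) +
      mismatch Y n m a v := by rw [hr5, hr4, r8]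
  refine run_assign ?_ ⟨?_, ?_, ?_⟩
  · simp only [Expr.Ok, Expr.val, BinOp.apply, true_and, h4, e, htr]
    omega
  · exact (hf5'.mono (by omega)).setReg le_rfl _
  · rw [State.setReg_reg, if_neg (by omega), hf5'.reg 5 (by omega), htv]
  · simp only [Expr.val, BinOp.apply, State.setReg_reg, if_pos, h4, e]

end

end StreamRAM

/-! ### Exhaustive search with a counter -/

/-- The digit of `x` in position `v` in base `B`. -/
def digitAt (B x v : ℕ) : ℕ := x / B ^ v % B

theorem digitAt_lt {B : ℕ} (hB : 0 < B) (x v : ℕ) : digitAt B x v < B := Nat.mod_lt _ hB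

theorem digitAt_add {B k v : ℕ} (hB : 0 < B) (hv : v < k) (y z : ℕ) :
    digitAt B (y + B ^ k * z) v = digitAt B y v := by
  obtain ⟨d, rfl⟩ := Nat.exists_eq_add_of_lt hv
  have e : B ^ (v + d + 1) * z = B ^ v * (B * (B ^ d * z)) := by ring
  rw [digitAt, e, Nat.add_mul_div_left _ _ (pow_pos hB v), Nat.add_mul_mod_self_left, digitAt]

theorem exists_digitAt_eq {B : ℕ} (hB : 0 < B) (b : ℕ → ℕ) (k : ℕ) (hb : ∀ v < k, b v < B) :
    ∃ y < B ^ k, ∀ v < k, digitAt B y v = b v := by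
  induction k with
  | zero => exact ⟨0, by simp, by simp⟩
  | succ k ih =>
    obtain ⟨y, hy, hyb⟩ := ih fun v hv => hb v (by omega)
    have hk := hb k (Nat.lt_succ_self k)
    refine ⟨y + B ^ k * b k, ?_, fun v hv => ?_⟩
    · have := Nat.mul_le_mul_left (B ^ k) (Nat.succ_le_of_lt hk)
      rw [Nat.mul_succ] at this
      rw [pow_succ]
      omega
    · rcases Nat.lt_succ_iff_lt_or_eq.1 hv with h | rfl
      · rw [digitAt_add hB h, hyb v h]
      · rw [digitAt, Nat.add_mul_div_left _ _ (pow_pos hB v), Nat.div_eq_of_lt hy, zero_add,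
          Nat.mod_eq_of_lt hk]

theorem digitAt_succ_of_not_dvd {B x k : ℕ} (h : ¬ B ^ k ∣ x + 1) :
    digitAt B (x + 1) k = digitAt B x k ∧ ¬ B ^ (k + 1) ∣ x + 1 := by
  refine ⟨?_, fun h' => h ((pow_dvd_pow B (Nat.le_succ k)).trans h')⟩
  rw [digitAt, Nat.succ_div, if_neg h, add_zero, digitAt]

/-- A carry enters position `k` exactly when `B ^ k` divides `x + 1`. It leaves the position exactly
when the digit wraps around to `0`. -/
theorem digitAt_succ_of_dvd {B x k : ℕ} (hB : 1 < B) (h : B ^ k ∣ x + 1) :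
    (digitAt B x k + 1 = B → digitAt B (x + 1) k = 0 ∧ B ^ (k + 1) ∣ x + 1) ∧
    (digitAt B x k + 1 ≠ B → digitAt B (x + 1) k = digitAt B x k + 1 ∧
      ¬ B ^ (k + 1) ∣ x + 1) := by
  have h1 : digitAt B (x + 1) k = (digitAt B x k + 1) % B := by
    rw [digitAt, Nat.succ_div, if_pos h, digitAt, Nat.mod_add_mod]
  have h2 : B ^ (k + 1) ∣ x + 1 ↔ digitAt B (x + 1) k = 0 := by
    rw [pow_succ, ← Nat.dvd_div_iff_mul_dvd h, digitAt, Nat.dvd_iff_mod_eq_zero]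
  have h3 := digitAt_lt (by omega : 0 < B) x k
  rw [h2, h1]
  refine ⟨fun h4 => ?_, fun h4 => ?_⟩
  · simp [h4]
  · rw [Nat.mod_eq_of_lt (by omega)]
    simp

theorem objective_congr {X Y : ℕ → ℕ → ℕ} {n m : ℕ} {a b : ℕ → ℕ} (h : ∀ v < n, a v = b v) :
    objective X Y n m a = objective X Y n m b := by
  unfold objective mismatch
  refine Finset.sum_congr rfl fun v hv => ?_
  rw [h v (Finset.mem_range.1 hv)]
  congr 1
  refine Finset.sum_congr rfl fun w hw => ?_
  rw [h w (Finset.mem_range.1 hw)]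

namespace StreamRAM

/-- Advances the cluster names in the cells `0, …, n - 1`, as the digits of a counter; an overflow
is added to register `3`. -/
def incrementCmd : Cmd :=
  .seq (.assign 5 (.lit 1))
  (.seq (forLoop 6 0
    (.ite (.reg 5)
      (.ite (.bin .eq (.bin .add (.load (.reg 6)) (.lit 1))
          (.bin .mul (.reg 0) (.bin .add (.reg 0) (.lit 1))))
        (.store (.reg 6) (.lit 0))
        (.seq (.store (.reg 6) (.bin .add (.load (.reg 6)) (.lit 1)))
          (.assign 5 (.lit 0))))
      .skip))
    (.assign 3 (.bin .add (.reg 3) (.reg 5))))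

/-- Finds cluster names that minimize the objective. -/
def searchCmd : Cmd :=
  .seq (.assign 3 (.lit 0))
  (.seq objectiveCmd
    (.loop (.bin .lt (.reg 3) (.reg 4)) (.seq incrementCmd objectiveCmd)))

section

variable {S W : ℕ} {ω : ℕ → Bool} {n m : ℕ} {X Y : ℕ → ℕ → ℕ} {s : State}

/-- Register `5` is the carry, the indicator of `B ^ k ∣ x + 1` before position `k`. The carry out
of position `n - 1` is the increment of `x / B ^ n`, which register `3` collects. -/
theorem run_incrementCmd (hc : Capacity S W n m) {x : ℕ}
    (h : Layout n m X Y (digitAt (n * (n + 1)) x) s)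
    (h3 : s.reg 3 = x / (n * (n + 1)) ^ n) (hx : x / (n * (n + 1)) ^ n + 1 < W) :
    Run S W ω incrementCmd s fun t => Layout n m X Y (digitAt (n * (n + 1)) (x + 1)) t ∧
      t.reg 3 = (x + 1) / (n * (n + 1)) ^ n := by
  have hn := hc.two_le
  have hB : 1 < n * (n + 1) := by nlinarith
  have hBW : n * (n + 1) + 1 < W := by
    have hw := hc.word
    obtain ⟨b1, b2, b3, b4, b5, b6⟩ := hc.bounds
    nlinarith
  have hnW : n + 1 < W := by nlinarith
  have hcm := hc.mem
  generalize hBd : n * (n + 1) = B at *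
  refine run_seq (R := fun t => t = s.setReg 5 1) (run_assign (show 1 < W by omega) rfl) ?_
  rintro _ rfl
  refine run_seq (run_forLoop (N := n) (fun k t => t.reg 6 = k ∧ (∀ r < 4, t.reg r = s.reg r) ∧
    t.reg 5 = (if B ^ k ∣ x + 1 then 1 else 0) ∧ (∀ i, n ≤ i → t.mem i = s.mem i) ∧
    ∀ v < n, t.mem v = if v < k then digitAt B (x + 1) v else digitAt B x v)
    (by omega) (by omega) ?_ ?_ ?_) ?_
  · rintro k t ⟨h6, hr, -⟩
    exact ⟨h6, (hr 0 (by omega)).trans h.reg0⟩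
  · rintro k hk t ⟨h6, hr, h5, hm, hd⟩
    have h0 := (hr 0 (by omega)).trans h.reg0
    have hdk := hd k hk
    rw [if_neg (lt_irrefl k)] at hdk
    have hdB := digitAt_lt (by omega : 0 < B) x k
    have hkS : k < S := by omega
    have key : ∀ t' : State, t'.reg 6 = k → (∀ r < 4, t'.reg r = s.reg r) →
        t'.reg 5 = (if B ^ (k + 1) ∣ x + 1 then 1 else 0) →
        t'.mem k = digitAt B (x + 1) k → (∀ i, i ≠ k → t'.mem i = t.mem i) →
        t'.reg 6 = k ∧ (t'.setReg 6 (k + 1)).reg 6 = k + 1 ∧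
        (∀ r < 4, (t'.setReg 6 (k + 1)).reg r = s.reg r) ∧
        (t'.setReg 6 (k + 1)).reg 5 = (if B ^ (k + 1) ∣ x + 1 then 1 else 0) ∧
        (∀ i, n ≤ i → (t'.setReg 6 (k + 1)).mem i = s.mem i) ∧
        ∀ v < n, (t'.setReg 6 (k + 1)).mem v =
          if v < k + 1 then digitAt B (x + 1) v else digitAt B x v := by
      intro t' h6' hr' h5' hk' hm'
      refine ⟨h6', by simp, fun r hr4 => ?_, ?_, fun i hi => ?_, fun v hv => ?_⟩
      · rw [State.setReg_reg, if_neg (by omega), hr' r hr4]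
      · rw [State.setReg_reg, if_neg (by omega), h5']
      · rw [State.setReg_mem, hm' i (by omega), hm i hi]
      · rw [State.setReg_mem]
        by_cases hvk : v = k
        · rw [hvk, hk', if_pos (by omega)]
        · rw [hm' v hvk, hd v hv]
          by_cases hlt : v < k
          · rw [if_pos hlt, if_pos (by omega)]
          · rw [if_neg hlt, if_neg (by omega)]
    refine run_ite trivial (fun hv => ?_) (fun hv => ?_)
    · have hdvd : B ^ k ∣ x + 1 := by
        by_contra hcon
        simp [Expr.val, h5, hcon] at hv
      obtain ⟨hA, hC⟩ := digitAt_succ_of_dvd hB hdvd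
      refine run_ite ?_ (fun hv => ?_) (fun hv => ?_)
      · simp only [Expr.Ok, Expr.val, BinOp.apply, h6, h0, hdk, hBd, true_and]
        refine ⟨⟨hkS, ?_, ?_⟩, ⟨⟨?_, ?_⟩, ?_⟩, ?_⟩ <;> (try split_ifs) <;> omega
      · simp only [Expr.val, BinOp.apply, h6, h0, hdk, hBd] at hv
        have he : digitAt B x k + 1 = B := by
          by_contra hcon
          simp [hcon] at hv
        obtain ⟨hA1, hA2⟩ := hA he
        refine run_store trivial (by simpa [Expr.val, h6] using hkS) (show 0 < W by omega)
          (key _ ?_ ?_ ?_ ?_ ?_)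
        · simp [h6]
        · simpa using hr
        · simp [h5, hdvd, hA2]
        · simp [Expr.val, h6, hA1]
        · intro i hi
          simp [Expr.val, h6, hi]
      · simp only [Expr.val, BinOp.apply, h6, h0, hdk, hBd] at hv
        have he : digitAt B x k + 1 ≠ B := by
          intro hcon
          simp [hcon] at hv
        obtain ⟨hC1, hC2⟩ := hC he
        refine run_seq (R := fun t' => t' = t.setMem k (digitAt B x k + 1))
          (run_store trivial (by simpa [Expr.val, h6] using hkS) ?_ ?_) ?_
        · simp only [Expr.Ok, Expr.val, BinOp.apply, h6, hdk, true_and]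
          omega
        · simp only [Expr.val, BinOp.apply, h6, hdk]
        rintro _ rfl
        refine run_assign (show 0 < W by omega) (key _ ?_ ?_ ?_ ?_ ?_)
        · simp [h6]
        · intro r hr4
          rw [State.setReg_reg, if_neg (by omega), State.setMem_reg, hr r hr4]
        · simp [Expr.val, hC2]
        · simp [hC1]
        · intro i hi
          simp [hi]
    · have hdvd : ¬ B ^ k ∣ x + 1 := by
        intro hcon
        simp [Expr.val, h5, hcon] at hv
      obtain ⟨hA, hC⟩ := digitAt_succ_of_not_dvd hdvd
      refine run_skip (key t h6 hr ?_ ?_ fun i _ => rfl)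
      · rw [h5, if_neg hdvd, if_neg hC]
      · rw [hdk, hA]
  · refine ⟨by simp, fun r hr => ?_, by simp, fun i _ => rfl, fun v hv => ?_⟩
    · rw [State.setReg_reg, if_neg (by omega), State.setReg_reg, if_neg (by omega)]
    · rw [if_neg (by omega)]
      exact h.name v hv
  · rintro t ⟨h6, hr, h5, hm, hd⟩
    have e3 : t.reg 3 + t.reg 5 = (x + 1) / B ^ n := by
      rw [hr 3 (by omega), h3, h5, Nat.succ_div]
    refine run_assign ?_ ⟨⟨?_, ?_, ?_, ?_, ?_, ?_⟩, ?_⟩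
    · simp only [Expr.Ok, Expr.val, BinOp.apply, true_and]
      rw [hr 3 (by omega), h3, h5]
      split_ifs <;> omega
    · simpa using (hr 0 (by omega)).trans h.reg0
    · simpa using (hr 1 (by omega)).trans h.reg1
    · simpa using (hr 2 (by omega)).trans h.reg2
    · intro j hj w hw
      rw [State.setReg_mem, hm _ (by omega)]
      exact h.sign j hj w hw
    · intro j hj w hw
      rw [State.setReg_mem, hm _ (by omega)]
      exact h.sketch j hj w hw
    · intro v hv
      rw [State.setReg_mem, hd v hv, if_pos hv]
    · simpa [Expr.val, BinOp.apply] using e3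

/-- The loop ends at the least `x` for which the naming with the last `n` digits of `x` has an
objective of at most `x / B ^ n`. Each naming `b` occurs once in the round numbered by its own
objective and satisfies the test there, so the threshold reached is at most the objective of every
`b`. -/
theorem run_searchCmd (hc : Capacity S W n m) (hX : ∀ j w, X j w ≤ 2)
    (hY : ∀ j u, Y j u ≤ 2 * n) (h : Layout n m X Y (fun _ => 0) s) :
    Run S W ω searchCmd s fun t => (∀ v < n, t.mem v < n * (n + 1)) ∧
      ∀ b : ℕ → ℕ, (∀ v < n, b v < n * (n + 1)) →
        objective X Y n m t.mem ≤ objective X Y n m b := by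
  have hn := hc.two_le
  have hB : 0 < n * (n + 1) := by positivity
  have hw := hc.word
  obtain ⟨b1, -⟩ := hc.bounds
  set B := n * (n + 1) with hBd
  have hBn : 0 < B ^ n := pow_pos hB n
  have hF : ∀ x, objective X Y n m (digitAt B x) ≤ 9 * (m * n ^ 3) := fun x =>
    objective_partial_le hX hY le_rfl
  -- The search terminates: the all-zero naming is accepted at the latest in the round numbered by
  -- its objective.
  have hex : ∃ x, objective X Y n m (digitAt B x) ≤ x / B ^ n := by
    refine ⟨B ^ n * objective X Y n m (digitAt B 0), ?_⟩
    rw [Nat.mul_div_cancel_left _ hBn]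
    refine le_of_eq (objective_congr fun v hv => ?_)
    have := digitAt_add hB hv 0 (objective X Y n m (digitAt B 0))
    rwa [zero_add] at this
  have hlt : ∀ k < Nat.find hex, k / B ^ n < objective X Y n m (digitAt B k) := fun k hk =>
    not_le.1 (Nat.find_min hex hk)
  refine run_seq (R := fun t => t = s.setReg 3 0) (run_assign (show 0 < W by omega) rfl) ?_
  rintro _ rfl
  have hl0 : Layout n m X Y (digitAt B 0) (s.setReg 3 0) := by
    have := h.frame ((Frame.refl 3 s).setReg le_rfl 0) le_rfl
    convert this using 1
    ext v
    simp [digitAt]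
  refine run_seq (run_objectiveCmd hc hX hY (fun v _ => digitAt_lt hB _ _) hl0) ?_
  rintro t ⟨hf, h4⟩
  refine run_loop (fun k t => Layout n m X Y (digitAt B k) t ∧ t.reg 3 = k / B ^ n ∧
    t.reg 4 = objective X Y n m (digitAt B k)) (Nat.zero_le (Nat.find hex)) ?_ ?_
    ⟨hl0.frame hf (by omega), by rw [hf.reg 3 (by omega)]; simp, h4⟩
  · rintro k hk t ⟨hl, h3, h4⟩
    have hk' := hlt k hk
    have hFk := hF k
    refine ⟨?_, ?_, run_seq (run_incrementCmd hc hl h3 (show k / B ^ n + 1 < W by omega)) ?_⟩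
    · simp only [Expr.Ok, Expr.val, BinOp.apply, true_and, h3, h4, if_pos hk']
      omega
    · simp [Expr.val, BinOp.apply, h3, h4, hk']
    · rintro t' ⟨hl', h3'⟩
      refine (run_objectiveCmd hc hX hY (fun v _ => digitAt_lt hB _ _) hl').mono ?_
      rintro t'' ⟨hf'', h4''⟩
      exact ⟨hl'.frame hf'' (by omega), by rw [hf''.reg 3 (by omega), h3'], h4''⟩
  · rintro t ⟨hl, h3, h4⟩
    have hfind := Nat.find_spec hex
    refine ⟨?_, ?_, fun v hv => ?_, fun b hb => ?_⟩
    · simp only [Expr.Ok, Expr.val, BinOp.apply, true_and, h3, h4, if_neg hfind.not_gt]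
      omega
    · simp only [Expr.val, BinOp.apply, h3, h4, if_neg hfind.not_gt]
    · rw [hl.name v hv]
      exact digitAt_lt hB _ _
    · rw [objective_congr hl.name]
      refine hfind.trans ?_
      by_contra hcon
      obtain ⟨y, hy, hyb⟩ := exists_digitAt_eq hB b n hb
      have hdig : ∀ v < n, digitAt B (y + B ^ n * objective X Y n m b) v = b v := fun v hv => by
        rw [digitAt_add hB hv, hyb v hv]
      have hle : Nat.find hex ≤ y + B ^ n * objective X Y n m b := by
        refine Nat.find_min' hex ?_
        rw [objective_congr hdig, Nat.add_mul_div_left _ _ hBn, Nat.div_eq_of_lt hy, zero_add]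
      have h5 : (y + B ^ n * objective X Y n m b) / B ^ n = objective X Y n m b := by
        rw [Nat.add_mul_div_left _ _ hBn, Nat.div_eq_of_lt hy, zero_add]
      have := Nat.div_le_div_right (c := B ^ n) hle
      omega

end

end StreamRAM

/-! ### Initializing the sketches and maintaining them along the stream -/

/-- A new element replaces a term `1` by `x w₀`. The additive form also shows that the truncated
subtraction in the update of a cell is exact. -/
theorem maskSum_insert {n : ℕ} {x : ℕ → ℕ} {A B : ℕ → Prop} {w₀ : ℕ} (hw : w₀ < n)
    (h0 : ¬ A w₀) (hB : ∀ w, B w ↔ A w ∨ w = w₀) :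
    maskSum n x B + 1 = maskSum n x A + x w₀ := by
  classical
  unfold maskSum
  have hmem := Finset.mem_range.2 hw
  rw [← Finset.add_sum_erase _ _ hmem, ← Finset.add_sum_erase (Finset.range n) (fun w =>
    if A w then x w else 1) hmem, if_pos ((hB w₀).2 (Or.inr rfl)), if_neg h0]
  have : ∀ w ∈ (Finset.range n).erase w₀, (if B w then x w else 1) = if A w then x w else 1 :=
    fun w hw => by
      have : B w ↔ A w := by rw [hB, or_iff_left (Finset.ne_of_mem_erase hw)]
      simp only [this]
  rw [Finset.sum_congr rfl this]
  ring

theorem maskSum_congr {n : ℕ} {x : ℕ → ℕ} {A B : ℕ → Prop} (hB : ∀ w, B w ↔ A w) :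
    maskSum n x B = maskSum n x A := by
  rw [show B = A from funext fun w => propext (hB w)]

/-- Adjacency by an edge of a list. -/
def listAdj {n : ℕ} (L : List (Fin n × Fin n)) (u w : ℕ) : Prop :=
  ∃ p ∈ L, s(p.1.val, p.2.val) = s(u, w)

theorem listAdj_append {n : ℕ} (L : List (Fin n × Fin n)) (x y : Fin n) (u w : ℕ) :
    listAdj (L ++ [(x, y)]) u w ↔ listAdj L u w ∨ s(x.val, y.val) = s(u, w) := by
  simp [listAdj, or_and_right, exists_or]

theorem listAdj_val {n : ℕ} (L : List (Fin n × Fin n)) (x y : Fin n) :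
    listAdj L x y ↔ s(x, y) ∈ L.map fun p => s(p.1, p.2) := by
  simp [listAdj, Fin.val_inj]

theorem listAdj_iff_natAdj {n : ℕ} {H : SimpleGraph (Fin n)} {L : List (Fin n × Fin n)}
    (h : IsEdgeStream H L) (u w : ℕ) : listAdj L u w ↔ natAdj H u w := by
  constructor
  · rintro ⟨p, hp, he⟩
    have hadj : H.Adj p.1 p.2 := (h.2 s(p.1, p.2)).1 (List.mem_map.2 ⟨p, hp, rfl⟩)
    rcases Sym2.eq_iff.1 he with ⟨rfl, rfl⟩ | ⟨rfl, rfl⟩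
    · exact ⟨p.1.2, p.2.2, hadj⟩
    · exact ⟨p.2.2, p.1.2, hadj.symm⟩
  · rintro ⟨hu, hw, hadj⟩
    exact (listAdj_val L ⟨u, hu⟩ ⟨w, hw⟩).2 ((h.2 _).2 hadj)

/-- The sketch of the graph of the edges of a list. -/
noncomputable def listSketch {n : ℕ} (X : ℕ → ℕ → ℕ) (L : List (Fin n × Fin n)) (j u : ℕ) : ℕ :=
  maskSum n (X j) (listAdj L u)

section

variable {n : ℕ} {X : ℕ → ℕ → ℕ} {L : List (Fin n × Fin n)} {x y : Fin n}

theorem listSketch_append_left (h : ¬ listAdj L x y) (j : ℕ) :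
    listSketch X (L ++ [(x, y)]) j x + 1 = listSketch X L j x + X j y := by
  refine maskSum_insert y.2 h fun w => ?_
  rw [listAdj_append, Sym2.congr_right, eq_comm (a := w)]

theorem listAdj_comm (u w : ℕ) : listAdj L u w ↔ listAdj L w u := by
  simp only [listAdj, Sym2.eq_swap (a := u)]

theorem listSketch_append_right (h : ¬ listAdj L x y) (j : ℕ) :
    listSketch X (L ++ [(x, y)]) j y + 1 = listSketch X L j y + X j x := by
  refine maskSum_insert x.2 (by rwa [listAdj_comm]) fun w => ?_
  rw [listAdj_append, Sym2.eq_swap, Sym2.congr_right, eq_comm (a := w)]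

theorem listSketch_append_of_ne {u : ℕ} (hx : u ≠ x) (hy : u ≠ y) (j : ℕ) :
    listSketch X (L ++ [(x, y)]) j u = listSketch X L j u := by
  refine maskSum_congr fun w => ?_
  rw [listAdj_append, or_iff_left]
  intro he
  rcases Sym2.eq_iff.1 he with ⟨h, -⟩ | ⟨-, h⟩
  · exact hx h.symm
  · exact hy h.symm

end

namespace StreamRAM

/-- Adds the sign of the vertex in register `w` to the sketch of the vertex in register `u`, in
row `8`. -/
def addSignCmd (u w : ℕ) : Cmd :=
  .store (sketchAddr 8 u) (.bin .sub
    (.bin .add (.load (sketchAddr 8 u)) (.load (signAddr (.reg 8) (.reg w)))) (.lit 1))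

/-- Adds the edge in the registers `6` and `7` to the sketches. -/
def addEdgeCmd : Cmd := forLoop 8 3 (.seq (addSignCmd 6 7) (addSignCmd 7 6))

/-- Sketches the graph of the edges of the stream. -/
def streamCmd : Cmd := .seq (.next 5 6 7) (.loop (.reg 5) (.seq addEdgeCmd (.next 5 6 7)))

/-- Computes the number of rows, draws the random signs and initializes the sketches. -/
def setupCmd (C : ℕ) : Cmd :=
  .seq (.assign 5 (.reg 0))
  (.seq (.loop (.bin .lt (.lit 1) (.reg 5))
    (.seq (.assign 5 (.bin .div (.reg 5) (.lit 2))) (.assign 1 (.bin .add (.reg 1) (.lit C)))))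
  (.seq (.assign 3 (.bin .mul (.lit 2) (.reg 1)))
  (.seq (.assign 6 (.bin .mul (.reg 3) (.reg 0)))
  (.seq (.assign 2 (.bin .add (.reg 0) (.reg 6)))
  (forLoop 5 6
    (.seq (.coin 7)
    (.seq (.store (.bin .add (.reg 0) (.reg 5)) (.bin .mul (.lit 2) (.reg 7)))
      (.store (.bin .add (.reg 2) (.reg 5)) (.reg 0)))))))))

section

variable {S W : ℕ} {ω : ℕ → Bool} {n m : ℕ} {X Y : ℕ → ℕ → ℕ} {a : ℕ → ℕ} {s : State}

theorem Layout.congr {Y' : ℕ → ℕ → ℕ} (h : Layout n m X Y a s)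
    (hY : ∀ j < 2 * m, ∀ u < n, Y j u = Y' j u) : Layout n m X Y' a s :=
  ⟨h.reg0, h.reg1, h.reg2, h.sign, fun j hj u hu => by rw [h.sketch j hj u hu, hY j hj u hu],
    h.name⟩

theorem Layout.setMem (h : Layout n m X Y a s) {j u : ℕ} (hu : u < n) (z : ℕ) :
    Layout n m X (fun j' u' => if j' = j ∧ u' = u then z else Y j' u') a
      (s.setMem (n + 2 * m * n + (j * n + u)) z) where
  reg0 := h.reg0
  reg1 := h.reg1
  reg2 := h.reg2
  sign j' hj' w hw := by
    have := mul_add_lt_mul hj' hw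
    rw [State.setMem_mem, if_neg (by omega)]
    exact h.sign j' hj' w hw
  sketch j' hj' u' hu' := by
    rw [State.setMem_mem, h.sketch j' hj' u' hu']
    refine if_congr ?_ rfl rfl
    refine ⟨fun he => ?_, fun he => by rw [he.1, he.2]⟩
    have h1 : j' * n + u' = j * n + u := by omega
    have h2 := congrArg (· / n) h1
    have h3 := congrArg (· % n) h1
    have hn : 0 < n := by omega
    simp only [mul_comm _ n, Nat.mul_add_div hn, Nat.mul_add_mod, Nat.div_eq_of_lt hu,
      Nat.div_eq_of_lt hu', Nat.mod_eq_of_lt hu, Nat.mod_eq_of_lt hu', add_zero] at h2 h3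
    exact ⟨h2, h3⟩
  name v hv := by
    rw [State.setMem_mem, if_neg (by omega)]
    exact h.name v hv

theorem run_addSignCmd (hc : Capacity S W n m) (hX : ∀ j w, X j w ≤ 2)
    (h : Layout n m X Y a s) {j u w u' w' : ℕ} (hj : s.reg 8 = j) (hjm : j < 2 * m)
    (hu : s.reg u' = u) (hun : u < n) (hw : s.reg w' = w) (hwn : w < n)
    (hY : Y j u ≤ 2 * n) {z : ℕ} (hz : z + 1 = Y j u + X j w) :
    Run S W ω (addSignCmd u' w') s fun t =>
      Layout n m X (fun j' u' => if j' = j ∧ u' = u then z else Y j' u') a t ∧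
        t.reg = s.reg ∧ t.input = s.input := by
  have hW := hc.word
  have hn := hc.two_le
  obtain ⟨b1, b2, b3, b4, b5, b6⟩ := hc.bounds
  obtain ⟨o1, o2, o3⟩ := h.sketchAddr_ok hc (j := 8) (u := u') (by omega) (by omega)
  obtain ⟨p1, p2, p3⟩ := h.signAddr_ok hc (j := .reg 8) (w := .reg w') trivial trivial
    (by simp only [Expr.val]; omega) (by simp only [Expr.val]; omega)
  rw [hj, hu] at o3
  have p4 : X (Expr.val s (.reg 8)) (Expr.val s (.reg w')) = X j w := by
    simp only [Expr.val, hj, hw]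
  rw [p4] at p3
  have hx := hX j w
  refine run_store o1 o2 ?_ ?_
  · simp only [Expr.Ok, Expr.val, BinOp.apply, o1, o2, o3, p1, p2, p3, true_and]
    omega
  · have e1 : (sketchAddr 8 u').val s = n + 2 * m * n + (j * n + u) := by
      simp only [sketchAddr, Expr.val, BinOp.apply, h.reg0, h.reg2, hj, hu]
    have e2 : Expr.val s (.bin .sub (.bin .add (.load (sketchAddr 8 u'))
        (.load (signAddr (.reg 8) (.reg w')))) (.lit 1)) = z := by
      simp only [Expr.val, BinOp.apply, o3, p3]
      omega
    rw [e1, e2]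
    exact ⟨h.setMem hun z, rfl, rfl⟩

/-- The rows below the counter already contain the new edge. Since `x ≠ y`, the two updates in a row
concern different cells; since the edge is new, each replaces a term `1`. -/
theorem run_addEdgeCmd (hc : Capacity S W n m) (hX : ∀ j w, X j w ≤ 2)
    {L : List (Fin n × Fin n)} {x y : Fin n} (h : Layout n m X (listSketch X L) a s)
    (h3 : s.reg 3 = 2 * m) (hx : s.reg 6 = x) (hy : s.reg 7 = y) (hxy : x ≠ y)
    (hL : ¬ listAdj L x y) :
    Run S W ω addEdgeCmd s fun t => Layout n m X (listSketch X (L ++ [(x, y)])) a t ∧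
      t.reg 3 = 2 * m ∧ t.input = s.input := by
  have hW := hc.word
  obtain ⟨b1, b2, b3, b4, b5, b6⟩ := hc.bounds
  have hxy' : (x : ℕ) ≠ y := fun he => hxy (Fin.ext he)
  refine (run_forLoop (N := 2 * m) (fun k t => Layout n m X (fun j u =>
      if j < k then listSketch X (L ++ [(x, y)]) j u else listSketch X L j u) a t ∧
      (∀ r < 8, t.reg r = s.reg r) ∧ t.reg 8 = k ∧ t.input = s.input)
    (by omega) (by omega) ?_ ?_ ?_).mono ?_
  · rintro k t ⟨-, hr, h8, -⟩
    exact ⟨h8, (hr 3 (by omega)).trans h3⟩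
  · rintro k hk t ⟨hl, hr, h8, hi⟩
    have hx6 := (hr 6 (by omega)).trans hx
    have hy7 := (hr 7 (by omega)).trans hy
    have hb : ∀ u, listSketch X L k u ≤ 2 * n := fun u => maskSum_le (hX k) _
    refine run_seq (run_addSignCmd hc hX hl h8 hk hx6 x.2 hy7 y.2 (by simpa using hb x)
      (z := listSketch X (L ++ [(x, y)]) k x)
      (by simpa using listSketch_append_left (X := X) hL k)) ?_
    rintro t₁ ⟨hl₁, hr₁, hi₁⟩
    refine (run_addSignCmd hc hX hl₁ (by rw [hr₁, h8]) hk (by rw [hr₁, hy7]) y.2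
      (by rw [hr₁, hx6]) x.2 (by simpa [hxy'.symm] using hb y)
      (z := listSketch X (L ++ [(x, y)]) k y)
      (by simpa [hxy'.symm] using listSketch_append_right (X := X) hL k)).mono ?_
    rintro t₂ ⟨hl₂, hr₂, hi₂⟩
    have hr₂' : t₂.reg = t.reg := hr₂.trans hr₁
    have hf : Frame 8 t₂ (t₂.setReg 8 (k + 1)) := (Frame.refl 8 t₂).setReg le_rfl _
    refine ⟨by rw [hr₂', h8], (hl₂.congr ?_).frame hf (by omega), fun r h8r => ?_, by simp, ?_⟩
    · intro j hj u hu
      by_cases hjk : j = k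
      · subst hjk
        by_cases huy : u = y
        · simp [huy]
        · by_cases hux : u = x
          · simp [hux, hxy']
          · simp [hux, huy, listSketch_append_of_ne hux huy]
      · have : j < k + 1 ↔ j < k := by omega
        simp [hjk, this]
    · rw [hf.reg r h8r, hr₂', hr r h8r]
    · rw [hf.input, hi₂, hi₁, hi]
  · have hf : Frame 8 s (s.setReg 8 0) := (Frame.refl 8 s).setReg le_rfl _
    exact ⟨(h.congr (by simp)).frame hf (by omega), hf.reg, by simp, hf.input⟩
  · rintro t ⟨hl, hr, -, hi⟩
    exact ⟨hl.congr fun j hj u _ => by simp [hj], (hr 3 (by omega)).trans h3, hi⟩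

theorem run_streamCmd (hc : Capacity S W n m) (hX : ∀ j w, X j w ≤ 2)
    (L₂ : List (Fin n × Fin n)) (L₁ : List (Fin n × Fin n))
    (hnd : ((L₁ ++ L₂).map fun p => s(p.1, p.2)).Nodup) (hne : ∀ p ∈ L₂, p.1 ≠ p.2)
    (h : Layout n m X (listSketch X L₁) a s) (h3 : s.reg 3 = 2 * m)
    (hi : s.input = L₂.map fun p => (p.1.val, p.2.val)) :
    Run S W ω streamCmd s (Layout n m X (listSketch X (L₁ ++ L₂)) a) := by
  induction L₂ generalizing L₁ s with
  | nil =>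
    refine ⟨_, .seq (.next_nil hi) (.loop_false ?_), ?_⟩
    · simp [Expr.eval]
    · rw [List.append_nil]
      exact h.frame ((Frame.refl 5 s).setReg le_rfl 0) (by omega)
  | cons p l ih =>
    obtain ⟨x, y⟩ := p
    have hfresh : ¬ listAdj L₁ x y := by
      rw [listAdj_val]
      rw [List.map_append, List.nodup_append'] at hnd
      exact fun hmem => hnd.2.2 hmem (by simp)
    set s₁ := ((({ s with input := l.map fun p => (p.1.val, p.2.val) } : State).setReg 5 1).setReg
      6 x.val).setReg 7 y.val with hs₁
    have hl₁ : Layout n m X (listSketch X L₁) a s₁ :=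
      ⟨h.reg0, h.reg1, h.reg2, h.sign, h.sketch, h.name⟩
    obtain ⟨t₁, ht₁, hl', h3', hi'⟩ := run_addEdgeCmd (ω := ω) hc hX hl₁ (by simpa [hs₁] using h3)
      (x := x) (y := y) (by simp [hs₁]) (by simp [hs₁]) (hne (x, y) (by simp)) hfresh
    obtain ⟨t, ht, hQ⟩ := ih (L₁ ++ [(x, y)]) (by simpa using hnd)
      (fun p hp => hne p (by simp [hp])) hl' h3' hi'
    -- The induction hypothesis starts with reading the next element. Its run is split so that this
    -- read ends the current pass and its loop becomes the remaining passes.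
    cases ht with
    | seq hnext hloop =>
      refine ⟨t, .seq (.next_cons (by simpa using hi)) (.loop_true (x := 1) ?_ one_ne_zero
        (.seq ht₁ hnext) hloop), by simpa using hQ⟩
      simp [Expr.eval]

end

end StreamRAM

namespace StreamRAM

/-- Repeated halving of `n` takes `Nat.log 2 n` passes, each of which adds `C` to the number of
rows. The sketch cells start at `n`, the sketch of a graph without edges. -/
theorem run_setupCmd {S W n C : ℕ} {ω : ℕ → Bool} (hC : 0 < C)
    (hc : Capacity S W n (C * Nat.log 2 n)) (L : List (Fin n × Fin n)) :
    Run S W ω (setupCmd C) (State.init n L) fun t =>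
      Layout n (C * Nat.log 2 n) (tapeSign n ω) (listSketch (n := n) (tapeSign n ω) []) (fun _ => 0) t ∧
        t.reg 3 = 2 * (C * Nat.log 2 n) ∧ t.input = L.map fun p => (p.1.val, p.2.val) := by
  have hn := hc.two_le
  have hw := hc.word
  have hcm := hc.mem
  obtain ⟨b1, b2, b3, b4, b5, b6⟩ := hc.bounds
  set N := Nat.log 2 n with hN
  have hN0 : 0 < N := Nat.log_pos (by norm_num) hn
  have hCN : C ≤ C * N := Nat.le_mul_of_pos_right C hN0
  refine run_seq (R := fun t => t = (State.init n L).setReg 5 n) (run_assign trivial ?_) ?_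
  · simp [Expr.val, State.init]
  rintro _ rfl
  refine run_seq (R := fun t => t.reg 0 = n ∧ t.reg 1 = C * N ∧ (∀ i, t.mem i = 0) ∧ t.used = 0 ∧
      t.input = L.map fun p => (p.1.val, p.2.val))
    (run_loop (fun k t => t.reg 5 = n / 2 ^ k ∧ t.reg 0 = n ∧ t.reg 1 = C * k ∧
      (∀ i, t.mem i = 0) ∧ t.used = 0 ∧ t.input = L.map fun p => (p.1.val, p.2.val))
      (Nat.zero_le N) ?_ ?_ ?_) ?_
  · rintro k hk t ⟨h5, h0, h1, hm, hu, hi⟩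
    have hpow : 2 ^ (k + 1) ≤ n := Nat.pow_le_of_le_log (by omega) hk
    have h2 : 1 < n / 2 ^ k := by
      rw [pow_succ] at hpow
      exact (Nat.le_div_iff_mul_le (by positivity)).2 (by linarith)
    have h3 : n / 2 ^ k ≤ n := Nat.div_le_self _ _
    have hCk : C * (k + 1) ≤ C * N := Nat.mul_le_mul_left C hk
    rw [Nat.mul_succ] at hCk
    refine ⟨?_, ?_, ?_⟩
    · simp only [Expr.Ok, Expr.val, BinOp.apply, true_and, h5, if_pos h2]
      omega
    · simp [Expr.val, BinOp.apply, h5, h2]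
    · refine run_seq (R := fun t' => t' = t.setReg 5 (n / 2 ^ (k + 1))) (run_assign ?_ ?_) ?_
      · simp only [Expr.Ok, Expr.val, BinOp.apply, true_and, h5]
        omega
      · simp only [Expr.val, BinOp.apply, h5, Nat.div_div_eq_div_mul, pow_succ]
      rintro _ rfl
      refine run_assign ?_ ⟨?_, ?_, ?_, hm, hu, hi⟩
      · simp [Expr.Ok, Expr.val, BinOp.apply, h1]
        omega
      · simp
      · simp [h0]
      · simp [Expr.val, BinOp.apply, h1, Nat.mul_succ]
  · rintro t ⟨h5, h0, h1, hm, hu, hi⟩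
    have h2 : n / 2 ^ N = 1 := by
      have h3 := Nat.pow_log_le_self 2 (by omega : n ≠ 0)
      have h4 := Nat.lt_pow_succ_log_self (b := 2) (by norm_num) n
      rw [pow_succ] at h4
      exact Nat.div_eq_of_lt_le (by simpa using h3) (by rw [mul_comm] at h4; exact h4)
    refine ⟨?_, ?_, h0, h1, hm, hu, hi⟩
    · simp only [Expr.Ok, Expr.val, BinOp.apply, true_and, h5, h2, lt_irrefl, if_false]
      omega
    · simp [Expr.val, BinOp.apply, h5, h2]
  · simp [State.init]
  rintro t ⟨h0, h1, hm, hu, hi⟩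
  set m := C * N with hmd
  have e6 : 2 * m * n = 2 * (m * n) := by ring
  refine run_seq (R := fun t' => t' = t.setReg 3 (2 * m)) (run_assign ?_ ?_) ?_
  · simp only [Expr.Ok, Expr.val, BinOp.apply, true_and, h1]
    omega
  · simp only [Expr.val, BinOp.apply, h1]
  rintro _ rfl
  refine run_seq (R := fun t' => t' = (t.setReg 3 (2 * m)).setReg 6 (2 * m * n))
    (run_assign ?_ ?_) ?_
  · simp [Expr.Ok, Expr.val, BinOp.apply, h0]
    omega
  · simp [Expr.val, BinOp.apply, h0]
  rintro _ rfl
  refine run_seq (R := fun t' => t' = ((t.setReg 3 (2 * m)).setReg 6 (2 * m * n)).setReg 2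
    (n + 2 * m * n)) (run_assign ?_ ?_) ?_
  · simp [Expr.Ok, Expr.val, BinOp.apply, h0]
    omega
  · simp [Expr.val, BinOp.apply, h0]
  rintro _ rfl
  refine (run_forLoop (N := 2 * m * n) (fun k t => t.reg 5 = k ∧ t.reg 6 = 2 * m * n ∧
    t.reg 0 = n ∧ t.reg 1 = m ∧ t.reg 2 = n + 2 * m * n ∧ t.reg 3 = 2 * m ∧ t.used = k ∧
    (∀ i < n, t.mem i = 0) ∧ (∀ i < k, t.mem (n + i) = 2 * (ω i).toNat) ∧
    (∀ i < k, t.mem (n + 2 * m * n + i) = n) ∧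
    t.input = L.map fun p => (p.1.val, p.2.val)) (by omega) (by omega) ?_ ?_ ?_).mono ?_
  · rintro k t ⟨h5, h6, -⟩
    exact ⟨h5, h6⟩
  · rintro k hk t ⟨h5, h6, h0, h1, h2, h3, hu, hm, hm1, hm2, hi⟩
    refine run_seq (R := fun t' => t' = ({ t with used := k + 1 } : State).setReg 7 (ω k).toNat)
      (run_coin (by rw [hu])) ?_
    rintro _ rfl
    have hb : (ω k).toNat ≤ 1 := Bool.toNat_le _
    refine run_seq (R := fun t' => t' = (({ t with used := k + 1 } : State).setReg 7
      (ω k).toNat).setMem (n + k) (2 * (ω k).toNat)) (run_store ?_ ?_ ?_ ?_) ?_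
    · simp [Expr.Ok, Expr.val, BinOp.apply, h0, h5]
      omega
    · simp [Expr.val, BinOp.apply, h0, h5]
      omega
    · simp [Expr.Ok, Expr.val, BinOp.apply]
      omega
    · simp [Expr.val, BinOp.apply, h0, h5]
    rintro _ rfl
    refine run_store ?_ ?_ trivial ?_
    · simp [Expr.Ok, Expr.val, BinOp.apply, h2, h5]
      omega
    · simp [Expr.val, BinOp.apply, h2, h5]
      omega
    · have e1 : Expr.val ((({ t with used := k + 1 } : State).setReg 7
          (ω k).toNat).setMem (n + k) (2 * (ω k).toNat)) (.bin .add (.reg 2) (.reg 5)) =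
          n + 2 * m * n + k := by
        simp [Expr.val, BinOp.apply, h2, h5]
      have e2 : Expr.val ((({ t with used := k + 1 } : State).setReg 7
          (ω k).toNat).setMem (n + k) (2 * (ω k).toNat)) (.reg 0) = n := by
        simp [Expr.val, h0]
      rw [e1, e2]
      refine ⟨by simp [h5], by simp, by simp [h6], by simp [h0], by simp [h1], by simp [h2],
        by simp [h3], by simp, fun i hi => ?_, fun i hi => ?_, fun i hi => ?_, by simpa using hi⟩
      · simp only [State.setReg_mem, State.setMem_mem]
        rw [if_neg (by omega), if_neg (by omega), hm i hi]
      · simp only [State.setReg_mem, State.setMem_mem]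
        rw [if_neg (by omega)]
        rcases Nat.lt_succ_iff_lt_or_eq.1 hi with h | rfl
        · rw [if_neg (by omega), hm1 i h]
        · rw [if_pos rfl]
      · simp only [State.setReg_mem, State.setMem_mem]
        rcases Nat.lt_succ_iff_lt_or_eq.1 hi with h | rfl
        · rw [if_neg (by omega), if_neg (by omega), hm2 i h]
        · rw [if_pos rfl]
  · simp [h0, h1, hm, hu, hi]
  · rintro t ⟨h5, h6, h0, h1, h2, h3, hu, hm, hm1, hm2, hi⟩
    refine ⟨⟨h0, h1, h2, fun j hj w hw => ?_, fun j hj u hu' => ?_, hm⟩, h3, hi⟩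
    · rw [hm1 _ (mul_add_lt_mul hj hw), tapeSign]
    · rw [hm2 _ (mul_add_lt_mul hj hu')]
      simp [listSketch, maskSum, listAdj]

/-! ### The whole program, its resources and its failure probability -/

/-- Single-pass streaming correlation clustering. -/
def clusterCmd (C : ℕ) : Cmd := .seq (setupCmd C) (.seq streamCmd searchCmd)

theorem run_clusterCmd {S W n C : ℕ} {ω : ℕ → Bool} (hC : 0 < C)
    (hc : Capacity S W n (C * Nat.log 2 n)) {H : SimpleGraph (Fin n)} {L : List (Fin n × Fin n)}
    (hL : IsEdgeStream H L) :
    Run S W ω (clusterCmd C) (State.init n L) fun t => (∀ v < n, t.mem v < n * (n + 1)) ∧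
      ∀ b : ℕ → ℕ, (∀ v < n, b v < n * (n + 1)) →
        objective (tapeSign n ω) (graphSketch H ω) n (C * Nat.log 2 n) t.mem ≤
          objective (tapeSign n ω) (graphSketch H ω) n (C * Nat.log 2 n) b := by
  have hX : ∀ j w, tapeSign n ω j w ≤ 2 := fun j w => by
    have := Bool.toNat_le (ω (j * n + w))
    unfold tapeSign
    omega
  have hsk : listSketch (tapeSign n ω) L = graphSketch H ω := by
    ext j u
    exact maskSum_congr fun w => listAdj_iff_natAdj hL u w
  refine run_seq (run_setupCmd hC hc L) ?_
  rintro t ⟨hl, h3, hi⟩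
  refine run_seq (run_streamCmd hc hX L [] hL.1 (fun p hp => ?_) hl h3 hi) ?_
  · have hadj : H.Adj p.1 p.2 := (hL.2 s(p.1, p.2)).1 (List.mem_map.2 ⟨p, hp, rfl⟩)
    exact hadj.ne
  · intro t' hl'
    rw [List.nil_append, hsk] at hl'
    exact run_searchCmd hc hX (fun j u => maskSum_le (hX j) _) hl'

/-- The memory holds `n` names and `2 * m * n` signs and as many sketch values. Constant factors in
the word size become powers of `n` because `n ≥ 2`: `64 ≤ n ^ 6` and `C < n ^ C`. -/
theorem capacity_of_two_le {n C : ℕ} (hn : 2 ≤ n) (hC : 0 < C) :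
    Capacity ((1 + 4 * C) * n * Nat.log 2 n ^ 1) (n ^ (C + 10)) n (C * Nat.log 2 n) := by
  have hN0 : 0 < Nat.log 2 n := Nat.log_pos (by norm_num) hn
  refine ⟨hn, Nat.mul_pos hC hN0, ?_, ?_⟩
  · have := Nat.le_mul_of_pos_right n hN0
    rw [pow_one]
    linarith
  · have h1 : Nat.log 2 n ≤ n := Nat.log_le_self 2 n
    have h2 : C < n ^ C := C.lt_two_pow_self.trans_le (Nat.pow_le_pow_left hn C)
    have h3 : 64 ≤ n ^ 6 := Nat.pow_le_pow_left hn 6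
    calc 64 * (C * Nat.log 2 n * n ^ 3) ≤ n ^ 6 * (C * n * n ^ 3) := by gcongr
      _ = C * n ^ 10 := by ring
      _ < n ^ C * n ^ 10 := by gcongr
      _ = n ^ (C + 10) := by rw [pow_add]

end StreamRAM

/-- With `32 * (c + 5)` rows per unit of `Nat.log 2 n`, the exponential is at most `n ^ (-(c + 5))`;
the spare `n ^ 5` absorbs the union bound. -/
theorem failure_prob_le {n c : ℕ} (hn : 2 ≤ n) :
    ((n : ℝ) * n + n * (n + 1)) *
      (2 * Real.exp (-(((32 * (c + 5) * Nat.log 2 n : ℕ) : ℝ) / 16))) ≤ 1 / (n : ℝ) ^ c := by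
  have hN0 : 0 < Nat.log 2 n := Nat.log_pos (by norm_num) hn
  set N := Nat.log 2 n
  have hn' : (2 : ℝ) ≤ n := by exact_mod_cast hn
  have h1 : (n : ℝ) ≤ Real.exp (2 * N) := by
    -- From `n < 2 ^ (N + 1)` and `N ≥ 1`; the rounding of the logarithm costs a factor `2` in the
    -- exponent.
    have h2 : n ≤ 4 ^ N := by
      have h3 := (Nat.lt_pow_succ_log_self (b := 2) (by norm_num) n).le
      refine h3.trans ?_
      rw [show 4 = 2 ^ 2 by norm_num, ← pow_mul]
      exact Nat.pow_le_pow_right (by norm_num) (by omega)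
    have h4 : (n : ℝ) ≤ 4 ^ N := by exact_mod_cast h2
    have h5 : (4 : ℝ) ≤ Real.exp 2 := by
      have h6 := Real.add_one_le_exp (1 : ℝ)
      have h7 : Real.exp 2 = Real.exp 1 * Real.exp 1 := by rw [← Real.exp_add]; norm_num
      nlinarith
    refine h4.trans ?_
    rw [mul_comm, Real.exp_nat_mul]
    gcongr
  have h2 : Real.exp (-(((32 * (c + 5) * N : ℕ) : ℝ) / 16)) = (Real.exp (2 * N) ^ (c + 5))⁻¹ := by
    rw [Real.exp_neg, ← Real.exp_nat_mul]
    congr 2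
    push_cast
    ring
  have h3 : (Real.exp (2 * N) ^ (c + 5))⁻¹ ≤ ((n : ℝ) ^ (c + 5))⁻¹ := by gcongr
  have h4 : ((n : ℝ) * n + n * (n + 1)) * 2 ≤ (n : ℝ) ^ 5 := by
    have h5 : (8 : ℝ) ≤ n ^ 3 := by
      have := pow_le_pow_left₀ (by norm_num) hn' 3
      norm_num at this
      exact this
    have h6 : (n : ℝ) ^ 5 = n ^ 3 * n ^ 2 := by ring
    nlinarith [sq_nonneg (n : ℝ)]
  rw [h2, ← mul_assoc]
  calc ((n : ℝ) * n + n * (n + 1)) * 2 * (Real.exp (2 * N) ^ (c + 5))⁻¹ ≤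
        (n : ℝ) ^ 5 * ((n : ℝ) ^ (c + 5))⁻¹ := by gcongr
    _ = 1 / (n : ℝ) ^ c := by
      rw [pow_add]
      field_simp

instance : IsProbabilityMeasure StreamRAM.coinTape := by
  unfold StreamRAM.coinTape
  infer_instance

theorem mainTheorem8 :
    ∃ (α : ℝ) (k : ℕ), ∀ c : ℕ, ∃ (P : StreamRAM.Cmd) (A q : ℕ),
      ∀ n : ℕ, 2 ≤ n → ∀ (G : LabeledGraph (Fin n)) (L : List (Fin n × Fin n)),
        IsEdgeStream G.neg L →
        (∀ ω : ℕ → Bool, ∃ t : StreamRAM.State,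
          StreamRAM.Exec (A * n * Nat.log 2 n ^ k) (n ^ q) ω P (StreamRAM.State.init n L) t) ∧
        1 - 1 / (n : ℝ) ^ c ≤
          StreamRAM.coinTape.real {ω : ℕ → Bool | ∃ t : StreamRAM.State,
            StreamRAM.Exec (A * n * Nat.log 2 n ^ k) (n ^ q) ω P (StreamRAM.State.init n L) t ∧
              G.IsApprox α (t.output n)} := by
  refine ⟨2800, 1, fun c => ⟨StreamRAM.clusterCmd (32 * (c + 5)), 1 + 4 * (32 * (c + 5)),
    32 * (c + 5) + 10, fun n hn G L hL => ?_⟩⟩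
  have hC : 0 < 32 * (c + 5) := by omega
  have hc := StreamRAM.capacity_of_two_le hn hC
  have hrun := fun ω => StreamRAM.run_clusterCmd (ω := ω) hC hc hL
  refine ⟨fun ω => (hrun ω).imp fun t ht => ht.1, ?_⟩
  set good := {ω : ℕ → Bool | ∃ t : StreamRAM.State,
    StreamRAM.Exec ((1 + 4 * (32 * (c + 5))) * n * Nat.log 2 n ^ 1) (n ^ (32 * (c + 5) + 10)) ω
      (StreamRAM.clusterCmd (32 * (c + 5))) (StreamRAM.State.init n L) t ∧
        G.IsApprox 2800 (t.output n)}
  set m := 32 * (c + 5) * Nat.log 2 n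
  set bad := {ω | ¬ IsAccurate G.posNbhd (nbhdEst G ω m) (ballEst G ω m) m}
  -- Covering the whole space bounds the measure of `good` from below by subadditivity alone, so no
  -- measurability has to be checked.
  have hcover : Set.univ ⊆ good ∪ bad := fun ω _ => by
    by_cases hacc : IsAccurate G.posNbhd (nbhdEst G ω m) (ballEst G ω m) m
    · obtain ⟨t, ht, hname, hmin⟩ := hrun ω
      exact Or.inl ⟨t, ht, G.isApprox_of_objective_le ω m (by omega) hc.pos hacc hname hmin⟩
    · exact Or.inr hacc
  have h1 := (measureReal_mono (μ := StreamRAM.coinTape) hcover).trans (measureReal_union_le _ _)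
  rw [probReal_univ] at h1
  have h2 := (coinTape_not_isAccurate_le G m).trans (failure_prob_le (c := c) hn)
  linarith
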